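/- Fix $n$. Let $\mathbb{O}$ be the set of symmetric $n\times n$ real matrices with nonnegative entries and zero diagonal; for $\Omega\in\mathbb{O}$ let $G(\Omega)$ be the graph on $\{1,\dots,n\}$ in which $i,j$ are joined iff $\Omega_{ij}>0$. Let $Q_i(\Omega)=I+D_i\Omega$, where $D_i$ is the diagonal matrix whose only nonzero entry is a $1$ at position $(i,i)$; we view $Q_1,\dots,Q_n$ as matrix-valued functions on $\mathbb{O}$ with pointwise multiplication. A product of these functions is called general if it can be written as a product of the $Q_i$ in which all of $Q_1,\dots,Q_n$ appear. For a closed path $\gamma=(i_1\ldots i_Ki_1)$ in the complete graph on $\{1,\dots,n\}$ and positive integers $p=(p_1,\dots,p_K)$ put $M_\gamma^p=Q_{i_K}^{p_K}\cdots Q_{i_1}^{p_1}$. Let $\partial\mathbb{O}$ be the set of rays from the origin in $\mathbb{O}$ (nonzero elements of $\mathbb{O}$ up to positive scaling). The graph $G(\Omega^*)$ and $\operatorname{rank}(\Omega^*)$ are well defined for $\Omega^*\in\partial\mathbb{O}$. A sequence $\Omega_k\in\mathbb{O}$ converges to $\Omega^*\in\partial\mathbb{O}$ if there are $t_k\to+\infty$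 such that $\Omega_k/t_k$ converges to a nonzero point of the ray $\Omega^*$. Let $\partial\mathbb{O}_\gamma$ be the set of those $\Omega^*\in\partial\mathbb{O}$ for which every edge of $\gamma$ is an edge of $G(\Omega^*)$. Suppose that $M_\gamma^p$ is general, that $\Omega_k\in\mathbb{O}$ is a sequence of matrices with integer entries and $\operatorname{rank}(\Omega_k)=r$ for all $k$, and that $\Omega_k$ converges to a point $\Omega^*\in\partial\mathbb{O}_\gamma$. Suppose furthermore that (i) $\gamma$ is contractible in $G(\Omega^*)$, that is, it can be transformed into the constant path $(i_1)$ by finitely many insertions and removals of backtrackings $(iji)$ along edges $ij$ of $G(\Omega^*)$, or (ii) $\operatorname{rank}(\Omega^*)=2$. Then, for all sufficiently large $k$, the matrix $M_\gamma^p(\Omega_k)$ is Perron--Frobenius (it has nonnegative entries and some positive power of it has strictly positive entries), and its Perron--Frobenius eigenvalue, i.e. its largest real eigenvalue, is an algebraic number of degree exactly $r$ over $\mathbb{Q}$. -/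

import Mathlib

open Filter Topology

namespace Penner

/-- The space of generalized intersection matrices: symmetric real `n × n` matrices with
nonnegative entries and vanishing diagonal. -/
def space (n : ℕ) : Set (Matrix (Fin n) (Fin n) ℝ) :=
  {A | A.IsSymm ∧ (∀ i j, 0 ≤ A i j) ∧ ∀ i, A i i = 0}

theorem smul_mem_space {n : ℕ} {A : Matrix (Fin n) (Fin n) ℝ} (hA : A ∈ space n) {c : ℝ}
    (hc : 0 < c) : c • A ∈ space n :=
  ⟨hA.1.smul c, fun i j => mul_nonneg hc.le (hA.2.1 i j), fun i => by simp [hA.2.2 i]⟩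

/-- Integral points: all entries are integers. -/
def IsIntegralPoint {n : ℕ} (Ω : space n) : Prop :=
  ∀ i j, ∃ m : ℤ, Ω.1 i j = m

/-- The graph on `{1, …, n}` in which `i` and `j` are joined iff the `(i,j)`-entry of `Ω` is
positive. -/
def graph {n : ℕ} (Ω : space n) : SimpleGraph (Fin n) where
  Adj i j := 0 < Ω.1 i j
  symm := ⟨fun i j h => by rw [Ω.2.1.apply i j]; exact h⟩
  loopless := ⟨fun i h => by rw [Ω.2.2.2 i] at h; exact lt_irrefl _ h⟩

/-- The boundary at infinity: the rays from the origin inside the space of generalized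
intersection matrices (a ray is a nonzero matrix up to positive scaling). -/
def Boundary (n : ℕ) : Type :=
  {ρ : Module.Ray ℝ (Matrix (Fin n) (Fin n) ℝ) // ρ.someVector ∈ space n}

namespace Boundary

/-- A chosen point on a ray. -/
noncomputable def rep {n : ℕ} (ρ : Boundary n) : space n :=
  ⟨ρ.1.someVector, ρ.2⟩

theorem rep_ne_zero {n : ℕ} (ρ : Boundary n) : ρ.rep.1 ≠ 0 :=
  ρ.1.someVector_ne_zero

/-- The graph of a boundary point (the graph is constant along rays). -/
noncomputable def graph {n : ℕ} (ρ : Boundary n) : SimpleGraph (Fin n) :=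
  Penner.graph ρ.rep

/-- The rank of a boundary point (the rank is constant along rays). -/
noncomputable def rank {n : ℕ} (ρ : Boundary n) : ℕ :=
  ρ.rep.1.rank

/-- The ray through a nonzero point. -/
noncomputable def ofPoint {n : ℕ} (A : space n) (hA : A.1 ≠ 0) : Boundary n :=
  ⟨rayOfNeZero ℝ A.1 hA, by
    have h := (ray_eq_iff (rayOfNeZero ℝ A.1 hA).someVector_ne_zero hA).1
      (rayOfNeZero ℝ A.1 hA).someVector_ray
    obtain ⟨c, hc, h⟩ := h.exists_pos_right (Module.Ray.someVector_ne_zero _) hA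
    rw [h]
    exact smul_mem_space A.2 hc⟩

theorem rep_ofPoint {n : ℕ} (A : space n) (hA : A.1 ≠ 0) :
    ∃ c : ℝ, 0 < c ∧ (ofPoint A hA).rep.1 = c • A.1 :=
  ((ray_eq_iff (rayOfNeZero ℝ A.1 hA).someVector_ne_zero hA).1
    (rayOfNeZero ℝ A.1 hA).someVector_ray).exists_pos_right
      (Module.Ray.someVector_ne_zero _) hA

theorem graph_ofPoint {n : ℕ} (A : space n) (hA : A.1 ≠ 0) :
    (ofPoint A hA).graph = Penner.graph A := by
  obtain ⟨c, hc, h⟩ := rep_ofPoint A hA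
  ext i j
  change 0 < (ofPoint A hA).rep.1 i j ↔ 0 < A.1 i j
  rw [h]
  simp [hc]

theorem rank_ofPoint {n : ℕ} (A : space n) (hA : A.1 ≠ 0) :
    (ofPoint A hA).rank = A.1.rank := by
  obtain ⟨c, hc, h⟩ := rep_ofPoint A hA
  rw [rank, h, Matrix.rank_smul_of_mem_nonZeroDivisors _ (mem_nonZeroDivisors_of_ne_zero hc.ne')]

end Boundary

/-- Convergence of a sequence of points to a point of the boundary in the radial
compactification: the points leave every bounded set and their directions converge to the given
ray, that is, `Ω k / t k` tends to a (nonzero) point of the ray for some scaling factors `t k`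
tending to infinity. -/
def ConvergesToBoundary {n : ℕ} (Ω : ℕ → space n) (ρ : Boundary n) : Prop :=
  ∃ t : ℕ → ℝ, Tendsto t atTop atTop ∧
    Tendsto (fun k => (t k)⁻¹ • (Ω k).1) atTop (𝓝 ρ.rep.1)

/-- Convergence to a boundary point can be tested with any point of the ray. -/
theorem convergesToBoundary_ofPoint {n : ℕ} (Ω : ℕ → space n) (A : space n) (hA : A.1 ≠ 0) :
    ConvergesToBoundary Ω (Boundary.ofPoint A hA) ↔
      ∃ t : ℕ → ℝ, Tendsto t atTop atTop ∧
        Tendsto (fun k => (t k)⁻¹ • (Ω k).1) atTop (𝓝 A.1) := by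
  obtain ⟨c, hc, h⟩ := Boundary.rep_ofPoint A hA
  constructor
  · rintro ⟨t, ht, hl⟩
    refine ⟨fun k => c * t k, ht.const_mul_atTop hc, ?_⟩
    have := hl.const_smul c⁻¹
    rw [h, smul_smul, inv_mul_cancel₀ hc.ne', one_smul] at this
    simpa [smul_smul, mul_comm] using this
  · rintro ⟨t, ht, hl⟩
    refine ⟨fun k => c⁻¹ * t k, ht.const_mul_atTop (inv_pos.2 hc), ?_⟩
    have := hl.const_smul c
    rw [h]
    simpa [smul_smul, mul_comm] using this

/-- The matrix-valued function `Q_i(Ω) = I + D_i Ω`, where `D_i` is the diagonal matrix whose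
`i`th diagonal entry is `1` and whose other entries are `0`. -/
def Q {n : ℕ} (i : Fin n) : space n → Matrix (Fin n) (Fin n) ℝ :=
  fun Ω => 1 + Matrix.diagonal (Pi.single i 1) * Ω.1

/-- General elements of the monoid (under pointwise matrix multiplication) of functions generated
by `Q_1, …, Q_n`: those that can be written as a product of generators in which all generators
appear. -/
def IsGeneral {n : ℕ} (M : space n → Matrix (Fin n) (Fin n) ℝ) : Prop :=
  ∃ l : List (Fin n), (∀ i, i ∈ l) ∧ M = (l.map Q).prod

/-- For a closed path `γ = (i_1 … i_K i_1)` in the complete graph and exponents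
`p_1, …, p_K`, the product `Q_{i_K}^{p_K} ⋯ Q_{i_1}^{p_1}`. -/
def pathProduct {n : ℕ} {i : Fin n} (γ : (⊤ : SimpleGraph (Fin n)).Walk i i)
    (p : Fin γ.length → ℕ) : space n → Matrix (Fin n) (Fin n) ℝ :=
  (List.ofFn fun k : Fin γ.length => Q (γ.getVert k) ^ p k).reverse.prod

/-- The path `γ` is contained in the graph `G`. -/
def PathIn {n : ℕ} {i : Fin n} (γ : (⊤ : SimpleGraph (Fin n)).Walk i i)
    (G : SimpleGraph (Fin n)) : Prop :=
  ∀ e ∈ γ.edges, e ∈ G.edgeSet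

/-- The second walk arises from the first by inserting one backtracking `(w x w)`. -/
inductive InsertBacktracking {V : Type} {G : SimpleGraph V} {u v : V} :
    G.Walk u v → G.Walk u v → Prop
  | insert {w x : V} (a : G.Walk u w) (h : G.Adj w x) (b : G.Walk w v) :
      InsertBacktracking (a.append b)
        (a.append (SimpleGraph.Walk.cons h (SimpleGraph.Walk.cons h.symm b)))

/-- Discrete homotopy of walks in `G` with the same endpoints: a finite sequence of insertions
and removals of backtrackings. -/
def DiscretelyHomotopic {V : Type} {G : SimpleGraph V} {u v : V} (a b : G.Walk u v) : Prop :=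
  Relation.EqvGen InsertBacktracking a b

/-- A closed walk in `G` is contractible if it is homotopic in `G` to the constant walk. -/
def Contractible {V : Type} {G : SimpleGraph V} {u : V} (a : G.Walk u u) : Prop :=
  DiscretelyHomotopic a SimpleGraph.Walk.nil

/-- `μ` is the largest real eigenvalue of `M`; for a Perron–Frobenius (that is, primitive) matrix
this is its Perron–Frobenius eigenvalue. -/
def IsPerronFrobeniusEigenvalue {n : ℕ} (M : Matrix (Fin n) (Fin n) ℝ) (μ : ℝ) : Prop :=
  IsGreatest {x : ℝ | Module.End.HasEigenvalue (Matrix.toLin' M) x} μ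

end Penner

/-!
Write the path product as `M = ∏ (I + p_j D_{g_j} Ω)`, where `g_0, …, g_{K-1}` are the successive
vertices of the path. Three facts give the theorem.

*The multiplicity of the eigenvalue `1`.* The factor `I + p D_g Ω` increases the quadratic form
`y ↦ yᵀ Ω y` by `2 p ((Ω y)_g)²`. Since every vertex occurs, a vector on which `M` preserves the
form is in the kernel of `Ω`; hence the generalized eigenspace of `M` for `1` is this kernel, and `1` has
algebraic multiplicity `n - r` (`rootMultiplicity_one_charpoly_add_rank`).

*The other eigenvalues.* By the Weinstein–Aronszajn identity, the characteristic polynomial of `M`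
is, up to powers of `x - 1`, the determinant of a `K × K` matrix with entries `Ω_{g_j g_l}`, those
below the diagonal being multiplied by `x` (`pow_mul_det_sub_orderedProd`). Divided by
`∏ p_j t_k`, it therefore converges to a polynomial `ℓ` determined by `Ω*`. Its coefficient in
degree `n - 1` is negative by a trace computation (`trace_orderedProd_pos`), and its only complex
roots are `0` and `1`: a null vector of the limit matrix is a sequence of vectors in the successive
hyperplanes `(Ω* y)_{g_j} = 0`, each arising from the preceding one by projection along `e_{g_j}`,
that closes up to the factor `x`. Such projections along a backtracking cancel modulo `e_{g_j}`, so
a contractible path forces `x ∈ {0, 1}`; for rank two the intersection of two successive hyperplanes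
is the kernel of `Ω*`, with the same consequence. So the largest eigenvalue of `M` tends to
infinity, while all other eigenvalues accumulate at `0` and `1` only (`eventually_exists_greatest_root`).

*Irreducibility.* The characteristic polynomial is `(X - 1)^(n-r) q` with `q` integral and
`q(1) ≠ 0`. If the minimal polynomial `m` of the largest eigenvalue were a proper factor, `q = m b`,
all roots of `b` would be near `0` or `1`. Their product is `±1` because `det M` is, so none is near
`0`, and then `b(1)` is an integer of absolute value less than one, contradicting `q(1) ≠ 0`
(`natDegree_minpoly_eq_of_roots_near`).

Finally `M ≥ I` entrywise and `M` is positive along the edges of the connected graph of `Ω*`, so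
that `M` is primitive (`isPrimitive_of_one_le`).
-/

namespace Penner

/-! ### Products of elementary matrices and their characteristic polynomials -/

/-- The product `A (j - 1) ⋯ A 1 * A 0`, with later factors on the left. -/
def orderedProd {R : Type*} [Monoid R] (A : ℕ → R) : ℕ → R
  | 0 => 1
  | j + 1 => A j * orderedProd A j

theorem orderedProd_congr {R : Type*} [Monoid R] {A B : ℕ → R} {K : ℕ}
    (h : ∀ j < K, A j = B j) : orderedProd A K = orderedProd B K := by
  induction K with
  | zero => rfl
  | succ K ih =>
    rw [orderedProd, orderedProd, h K (Nat.lt_succ_self K),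
      ih fun j hj => h j (hj.trans (Nat.lt_succ_self K))]

theorem map_orderedProd {R S F : Type*} [Monoid R] [Monoid S] [FunLike F R S]
    [MonoidHomClass F R S] (f : F) (A : ℕ → R) (K : ℕ) :
    f (orderedProd A K) = orderedProd (fun j => f (A j)) K := by
  induction K with
  | zero => simp [orderedProd]
  | succ K ih => simp [orderedProd, ih]

theorem prod_reverse_ofFn {R : Type*} [Monoid R] (A : ℕ → R) (K : ℕ) :
    (List.ofFn fun k : Fin K => A k).reverse.prod = orderedProd A K := by
  induction K with
  | zero => simp [orderedProd]
  | succ K ih =>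
    rw [List.ofFn_succ', orderedProd, ← ih]
    simp

theorem diagonal_single_mul_apply {ι R : Type*} [Fintype ι] [DecidableEq ι] [CommRing R]
    (W : Matrix ι ι R) (g a b : ι) :
    (Matrix.diagonal (Pi.single g (1 : R)) * W) a b = if a = g then W g b else 0 := by
  rw [Matrix.diagonal_mul]
  by_cases h : a = g
  · subst h; simp
  · simp [h]

theorem diagonal_single_mul_eq_vecMulVec {ι R : Type*} [Fintype ι] [DecidableEq ι] [CommRing R]
    (W : Matrix ι ι R) (g : ι) :
    Matrix.diagonal (Pi.single g (1 : R)) * W = Matrix.vecMulVec (Pi.single g 1) (W g) := by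
  ext a b
  rw [diagonal_single_mul_apply, Matrix.vecMulVec_apply, Pi.single_apply]
  split_ifs <;> simp

/-- If `W` has zero diagonal, then `D_g W` squares to zero, so that powers of `I + D_g W` are
linear in the exponent. -/
theorem one_add_diagonal_mul_pow {ι R : Type*} [Fintype ι] [DecidableEq ι] [CommRing R]
    {W : Matrix ι ι R} (g : ι) (hW : W g g = 0) (m : ℕ) :
    (1 + Matrix.diagonal (Pi.single g (1 : R)) * W) ^ m =
      1 + (m : R) • (Matrix.diagonal (Pi.single g (1 : R)) * W) := by
  set A := Matrix.diagonal (Pi.single g (1 : R)) * W with hA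
  have hsq : A * A = 0 := by
    rw [hA, diagonal_single_mul_eq_vecMulVec, Matrix.vecMulVec_mul_vecMulVec]
    simp [hW]
  induction m with
  | zero => simp
  | succ m ih =>
    rw [pow_succ, ih, mul_add, mul_one, add_mul, one_mul, smul_mul_assoc, hsq]
    push_cast
    rw [smul_zero, add_zero, add_smul, one_smul]
    abel

/-- A product of elementary matrices `I + u_j w_j` differs from the identity by a sum of rank one
matrices, by telescoping. -/
theorem orderedProd_one_add_vecMulVec {ι R : Type*} [Fintype ι] [DecidableEq ι] [CommRing R]
    (u w : ℕ → ι → R) (K : ℕ) :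
    orderedProd (fun j => 1 + Matrix.vecMulVec (u j) (w j)) K =
      1 + ∑ l ∈ Finset.range K, Matrix.vecMulVec (u l)
        (Matrix.vecMul (w l) (orderedProd (fun j => 1 + Matrix.vecMulVec (u j) (w j)) l)) := by
  induction K with
  | zero => simp [orderedProd]
  | succ K ih =>
    rw [Finset.sum_range_succ, ← add_assoc, ← ih, orderedProd, add_mul, one_mul,
      Matrix.vecMulVec_mul]

theorem pow_mul_det_sub_mul {m k R : Type*} [Fintype m] [DecidableEq m] [Fintype k]
    [DecidableEq k] [CommRing R] (A : Matrix m k R) (B : Matrix k m R) (y : R) :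
    y ^ Fintype.card k * (y • (1 : Matrix m m R) - A * B).det =
      y ^ Fintype.card m * (y • (1 : Matrix k k R) - B * A).det := by
  have h := congrArg (Polynomial.eval y) (Matrix.charpoly_mul_comm' A B)
  simpa [Matrix.eval_charpoly, ← Matrix.smul_one_eq_diagonal] using h

/-- The characteristic polynomial of a product of elementary matrices `I + u_j w_j`, expressed by
the pairings `w_j u_l`: away from the eigenvalue `1`, it is a determinant of the size of the number
of factors, in which the pairings below the diagonal are weighted by the variable. -/
theorem pow_mul_det_sub_orderedProd {ι R : Type*} [Fintype ι] [DecidableEq ι] [CommRing R]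
    (u w : ℕ → ι → R) (K : ℕ) (x : R) :
    (x - 1) ^ K * (x • (1 : Matrix ι ι R) -
        orderedProd (fun j => 1 + Matrix.vecMulVec (u j) (w j)) K).det =
      (x - 1) ^ Fintype.card ι * ((x - 1) • (1 : Matrix (Fin K) (Fin K) R) -
        Matrix.of fun j l : Fin K => (if l < j then x else 1) * (w j ⬝ᵥ u l)).det := by
  set M := orderedProd (fun j => 1 + Matrix.vecMulVec (u j) (w j)) with hM
  set U : Matrix ι (Fin K) R := Matrix.of fun a l => u l a with hU
  set A : Matrix (Fin K) ι R := Matrix.of fun j => Matrix.vecMul (w j) (M j) with hA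
  set W : Matrix (Fin K) ι R := Matrix.of fun j => w j with hW
  set N : Matrix (Fin K) (Fin K) R :=
    Matrix.of fun j l => if l < j then w j ⬝ᵥ u l else 0 with hN
  have hMK : M K = 1 + U * A := by
    rw [hM, orderedProd_one_add_vecMulVec, ← hM]
    congr 1
    ext a b
    rw [Matrix.sum_apply, Matrix.mul_apply, Finset.sum_range]
    rfl
  have hNA : (1 - N) * A = W := by
    rw [Matrix.sub_mul, Matrix.one_mul]
    ext j b
    have h1 : A j b = w j b + ∑ l ∈ Finset.range j, (w j ⬝ᵥ u l) * Matrix.vecMul (w l) (M l) b := by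
      change Matrix.vecMul (w j) (M j) b = _
      rw [hM, orderedProd_one_add_vecMulVec, ← hM, Matrix.vecMul_add, Matrix.vecMul_one,
        Pi.add_apply, Matrix.vecMul_sum, Finset.sum_apply]
      congr 1
      refine Finset.sum_congr rfl fun l _ => ?_
      rw [Matrix.vecMul_vecMulVec]
      rfl
    have h2 : (N * A) j b = ∑ l ∈ Finset.range j, (w j ⬝ᵥ u l) * Matrix.vecMul (w l) (M l) b := by
      rw [Matrix.mul_apply, ← Fin.sum_univ_eq_sum_range
        (fun l => (w j ⬝ᵥ u l) * Matrix.vecMul (w l) (M l) b), Fin.sum_univ_eq_sum_range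
        (fun l => (w j ⬝ᵥ u l) * Matrix.vecMul (w l) (M l) b)]
      have : ∀ l : Fin K, N j l * A l b =
          (fun l : ℕ => if l < j then (w j ⬝ᵥ u l) * Matrix.vecMul (w l) (M l) b else 0) l := by
        intro l
        simp only [hN, hA, Matrix.of_apply, Fin.lt_def, ite_mul, zero_mul]
      rw [Finset.sum_congr rfl fun l _ => this l, Fin.sum_univ_eq_sum_range
        (fun l : ℕ => if l < j then (w j ⬝ᵥ u l) * Matrix.vecMul (w l) (M l) b else 0),
        ← Finset.sum_filter]
      refine Finset.sum_congr ?_ fun _ _ => rfl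
      ext l
      have := j.2
      simp only [Finset.mem_filter, Finset.mem_range]
      omega
    rw [Matrix.sub_apply, h1, h2, add_sub_cancel_right]
    rfl
  have hdet : (1 - N).det = 1 := by
    rw [Matrix.det_of_isLowerTriangular]
    · simp [hN]
    · intro i j hij
      have hij : i < j := hij
      simp [hN, hij.ne, hij.not_gt]
  have key := pow_mul_det_sub_mul U A (x - 1)
  rw [Fintype.card_fin] at key
  have e1 : x • (1 : Matrix ι ι R) - M K = (x - 1) • 1 - U * A := by
    rw [hMK, sub_smul, one_smul]; abel
  have e2 : ((x - 1) • 1 - A * U).det = ((1 - N) * ((x - 1) • 1 - A * U)).det := by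
    rw [Matrix.det_mul, hdet, one_mul]
  rw [e1, key, e2, mul_sub, ← Matrix.mul_assoc, hNA]
  congr 2
  ext j l
  have hWU : (W * U) j l = w j ⬝ᵥ u l := rfl
  rw [Matrix.mul_smul, mul_one, Matrix.sub_apply, Matrix.sub_apply, hWU, Matrix.smul_apply,
    Matrix.sub_apply, Matrix.of_apply, Matrix.smul_apply]
  simp only [hN, Matrix.of_apply, smul_eq_mul]
  split_ifs <;> ring

/-! ### Transport along walks and null vectors of the limit matrix -/

section Transport

variable {ι : Type} [Fintype ι] [DecidableEq ι] {F : Type*} [Field F]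

/-- The projection onto the hyperplane `(W x)_v = 0` in the direction of the basis vector `e_u`
(meaningful if `W v u ≠ 0`). -/
def edgeProjection (W : Matrix ι ι F) (u v : ι) : (ι → F) →ₗ[F] (ι → F) :=
  LinearMap.id - (LinearMap.proj v ∘ₗ W.mulVecLin).smulRight (Pi.single u (W v u)⁻¹)

theorem edgeProjection_apply (W : Matrix ι ι F) (u v : ι) (x : ι → F) :
    edgeProjection W u v x = x - ((W.mulVec x) v * (W v u)⁻¹) • Pi.single u 1 := by
  simp only [edgeProjection, LinearMap.sub_apply, LinearMap.id_apply, LinearMap.smulRight_apply,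
    LinearMap.comp_apply, Matrix.mulVecLin_apply, LinearMap.proj_apply, mul_smul]
  congr 2
  ext a
  simp [Pi.single_apply]

theorem mulVec_add_smul_single (W : Matrix ι ι F) (x : ι → F) (s : F) (u a : ι) :
    W.mulVec (x + s • Pi.single u 1) a = W.mulVec x a + s * W a u := by
  simp [Matrix.mulVec_add, Matrix.mulVec_smul]

theorem mulVec_edgeProjection (W : Matrix ι ι F) (u v a : ι) (x : ι → F) :
    W.mulVec (edgeProjection W u v x) a =
      W.mulVec x a - (W.mulVec x) v * (W v u)⁻¹ * W a u := by
  rw [edgeProjection_apply, sub_eq_add_neg, ← neg_smul, mulVec_add_smul_single]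
  ring

theorem edgeProjection_single {W : Matrix ι ι F} {u v : ι} (h : W v u ≠ 0) :
    edgeProjection W u v (Pi.single u 1) = 0 := by
  rw [edgeProjection_apply]
  simp [h]

theorem edgeProjection_of_mulVec_eq_zero {W : Matrix ι ι F} {u v : ι} {x : ι → F}
    (h : W.mulVec x v = 0) : edgeProjection W u v x = x := by
  simp [edgeProjection_apply, h]

/-- The composition of the projections belonging to the edges of a walk. -/
def transport (W : Matrix ι ι F) {G : SimpleGraph ι} :
    {u v : ι} → G.Walk u v → (ι → F) →ₗ[F] (ι → F)
  | _, _, .nil => LinearMap.id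
  | u, _, .cons (v := w) _ p => transport W p ∘ₗ edgeProjection W u w

theorem transport_cons_apply (W : Matrix ι ι F) {G : SimpleGraph ι} {u v w : ι} (h : G.Adj u w)
    (p : G.Walk w v) (x : ι → F) :
    transport W (.cons h p) x = transport W p (edgeProjection W u w x) := rfl

theorem transport_append (W : Matrix ι ι F) {G : SimpleGraph ι} {u v w : ι} (p : G.Walk u v)
    (q : G.Walk v w) (x : ι → F) :
    transport W (p.append q) x = transport W q (transport W p x) := by
  induction p generalizing x with
  | nil => rfl
  | cons h p ih =>
    rw [SimpleGraph.Walk.cons_append, transport_cons_apply, transport_cons_apply, ih]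

variable {W : Matrix ι ι F} {G : SimpleGraph ι}

theorem mulVec_transport {u v : ι} (hW : ∀ u v, G.Adj u v → W v u ≠ 0) (p : G.Walk u v)
    {x : ι → F} (hx : W.mulVec x u = 0) : W.mulVec (transport W p x) v = 0 := by
  induction p generalizing x with
  | nil => exact hx
  | cons h p ih =>
    refine ih ?_
    rw [mulVec_edgeProjection, mul_assoc, inv_mul_cancel₀ (hW _ _ h), mul_one, sub_self]

theorem transport_single {u v : ι} (hW : ∀ u v, G.Adj u v → W v u ≠ 0) (p : G.Walk u v) :
    ∃ s : F, transport W p (Pi.single u 1) = s • Pi.single v 1 := by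
  cases p with
  | nil => exact ⟨1, (one_smul _ _).symm⟩
  | cons h p =>
    refine ⟨0, ?_⟩
    rw [transport_cons_apply, edgeProjection_single (hW _ _ h), map_zero, zero_smul]

/-- On the hyperplane belonging to the initial vertex, homotopic walks have the same transport up
to multiples of the basis vector of the terminal vertex: going along `u → v → u` moves a vector
only in the direction of `e_u`. -/
theorem transport_sub_transport_of_homotopic {u v : ι} (hW : ∀ u v, G.Adj u v → W v u ≠ 0)
    (hdiag : ∀ u, W u u = 0) {p q : G.Walk u v} (hpq : DiscretelyHomotopic p q) {x : ι → F}
    (hx : W.mulVec x u = 0) : ∃ s : F, transport W p x - transport W q x = s • Pi.single v 1 := by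
  induction hpq with
  | rel p q h =>
    obtain ⟨a, h, b⟩ := h
    rename_i w y
    rw [transport_append, transport_append, transport_cons_apply, transport_cons_apply]
    have hy := mulVec_transport hW a hx
    set z := transport W a x with hz
    rw [edgeProjection_of_mulVec_eq_zero (u := y) (v := w), ← map_sub, edgeProjection_apply,
      sub_sub_cancel, map_smul]
    · obtain ⟨s, hs⟩ := transport_single hW b
      exact ⟨_, by rw [hs, smul_smul]⟩
    · rw [mulVec_edgeProjection, hdiag, hy, mul_zero, sub_zero]
  | refl p => exact ⟨0, by simp⟩
  | symm p q _ ih =>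
    obtain ⟨s, hs⟩ := ih
    exact ⟨-s, by rw [neg_smul, ← hs, neg_sub]⟩
  | trans p q r _ _ ih₁ ih₂ =>
    obtain ⟨s, hs⟩ := ih₁
    obtain ⟨t, ht⟩ := ih₂
    exact ⟨s + t, by rw [add_smul, ← hs, ← ht, sub_add_sub_cancel]⟩

theorem transport_eq_of_forall_step {u w : ι} (hW : ∀ u v, G.Adj u v → W v u ≠ 0)
    (p : G.Walk u w) (v : ℕ → ι → F)
    (hv : ∀ j ≤ p.length, W.mulVec (v j) (p.getVert j) = 0)
    (hstep : ∀ j < p.length, ∃ a : F, v (j + 1) = v j + a • Pi.single (p.getVert j) 1) :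
    transport W p (v 0) = v p.length := by
  induction p generalizing v with
  | nil => rfl
  | @cons u y w h p ih =>
    rw [transport_cons_apply]
    have h1 : edgeProjection W u y (v 0) = v 1 := by
      obtain ⟨a, ha⟩ := hstep 0 (by simp)
      have h2 := hv 1 (by simp)
      rw [zero_add, SimpleGraph.Walk.getVert_zero] at ha
      rw [SimpleGraph.Walk.getVert_cons_succ, SimpleGraph.Walk.getVert_zero, ha,
        mulVec_add_smul_single] at h2
      rw [edgeProjection_apply, ha, eq_neg_of_add_eq_zero_left h2, sub_eq_add_neg, ← neg_smul,
        neg_mul, neg_neg, mul_assoc, mul_inv_cancel₀ (hW _ _ h), mul_one]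
    rw [h1]
    exact ih (fun j => v (j + 1))
      (fun j hj => hv (j + 1) (by simpa using hj))
      (fun j hj => hstep (j + 1) (by simpa using hj))

end Transport

/-- The limit, up to sign, of the rescaled matrices of pairings: the entries `W (g j) (g l)`,
with those below the diagonal weighted by `x`. -/
def weightedGram {ι R : Type*} [CommRing R] (W : Matrix ι ι R) (g : ℕ → ι) (K : ℕ) (x : R) :
    Matrix (Fin K) (Fin K) R :=
  Matrix.of fun j l => (if l < j then x else 1) * W (g j) (g l)

theorem det_weightedGram_ne_zero_of_forall {ι F : Type*} [Field F] {W : Matrix ι ι F}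
    {g : ℕ → ι} {K : ℕ} {x : F}
    (h : ∀ a : ℕ → F, (weightedGram W g K x).mulVec (fun l => a l) = 0 → ∀ l < K, a l = 0) :
    (weightedGram W g K x).det ≠ 0 := by
  intro hdet
  obtain ⟨a, ha0, ha⟩ := Matrix.exists_mulVec_eq_zero_iff.2 hdet
  refine ha0 (funext fun l => ?_)
  have := h (fun l => if hl : l < K then a ⟨l, hl⟩ else 0) (by simpa using ha) l l.2
  simpa using this

section NullVector

variable {ι : Type} [Fintype ι] [DecidableEq ι] {F : Type*} [Field F]

/-- A null vector `a` of the weighted matrix of pairings gives a sequence of vectors, obtained by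
successively adding `a_j e_{g_j}`, which lies in the successive hyperplanes and
closes up to the factor `x`. -/
theorem exists_seq_of_weightedGram_mulVec_eq_zero {W : Matrix ι ι F} {g : ℕ → ι} {K : ℕ} {x : F}
    (hx : x ≠ 1) {a : ℕ → F}
    (ha : (weightedGram W g K x).mulVec (fun l => a l) = 0) :
    ∃ v : ℕ → ι → F, (∀ j, v (j + 1) = v j + a j • Pi.single (g j) 1) ∧ v K = x • v 0 ∧
      ∀ j < K, W.mulVec (v j) (g j) = 0 := by
  have hx' : x - 1 ≠ 0 := sub_ne_zero.2 hx
  set S : ℕ → ι → F := fun j => ∑ l ∈ Finset.range j, a l • Pi.single (g l) 1 with hS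
  have hmul : ∀ j b, W.mulVec (S j) b = ∑ l ∈ Finset.range j, a l * W b (g l) := by
    intro j b
    simp [hS, Matrix.mulVec_sum, Matrix.mulVec_smul, Finset.sum_apply]
  refine ⟨fun j => (x - 1)⁻¹ • S K + S j, fun j => ?_, ?_, fun j hj => ?_⟩
  · simp only [hS, Finset.sum_range_succ, add_assoc]
  · have h0 : S 0 = 0 := by simp [hS]
    simp only [h0, add_zero]
    have hxx : x * (x - 1)⁻¹ = (x - 1)⁻¹ + 1 := by field_simp; ring
    rw [smul_smul, hxx, add_smul, one_smul]
  · have h := congrFun ha ⟨j, hj⟩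
    have h1 : ∑ l ∈ Finset.range K, (if l < j then x else 1) * W (g j) (g l) * a l = 0 := by
      rw [Finset.sum_range]
      simp only [Matrix.mulVec, dotProduct, weightedGram, Matrix.of_apply, Pi.zero_apply,
        Fin.lt_def] at h
      exact h
    have h2 : ∑ l ∈ Finset.range j, a l * W (g j) (g l) =
        ∑ l ∈ Finset.range K, if l < j then a l * W (g j) (g l) else 0 := by
      rw [← Finset.sum_filter]
      refine Finset.sum_congr ?_ fun _ _ => rfl
      ext l
      simp only [Finset.mem_filter, Finset.mem_range]
      omega
    rw [Matrix.mulVec_add, Matrix.mulVec_smul, Pi.add_apply, Pi.smul_apply, hmul, hmul, h2,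
      smul_eq_mul]
    refine (mul_eq_zero.1 (?_ : (x - 1) * _ = 0)).resolve_left hx'
    rw [mul_add, mul_inv_cancel_left₀ hx', Finset.mul_sum, ← Finset.sum_add_distrib]
    refine Eq.trans ?_ h1
    refine Finset.sum_congr rfl fun l _ => ?_
    split_ifs <;> ring

theorem eq_zero_of_consecutive_mulVec_eq_zero {W : Matrix ι ι F} {g h : ι} (hW : W h g ≠ 0)
    {y z : ι → F} {a : F} (hz : z = y + a • Pi.single g 1) (hy0 : W.mulVec y h = 0)
    (hz0 : W.mulVec z h = 0) : a = 0 := by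
  rw [hz, mulVec_add_smul_single, hy0, zero_add] at hz0
  exact (mul_eq_zero.1 hz0).resolve_right hW

/-- If the closed walk is contractible, the weighted matrix of pairings is singular at most at
`x = 0` and `x = 1`: the transport along the walk multiplies the first vector of the sequence
by `x`, but it is also the identity up to multiples of a basis vector. -/
theorem det_weightedGram_ne_zero_of_contractible {W : Matrix ι ι F} {G : SimpleGraph ι}
    (hW : ∀ u v, G.Adj u v → W v u ≠ 0) (hdiag : ∀ u, W u u = 0) {i : ι} {γ : G.Walk i i}
    (hγ : Contractible γ) {x : F} (hx0 : x ≠ 0) (hx1 : x ≠ 1) :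
    (weightedGram W γ.getVert γ.length x).det ≠ 0 := by
  refine det_weightedGram_ne_zero_of_forall fun a ha => ?_
  rcases Nat.eq_zero_or_pos γ.length with hK | hK
  · intro l hl
    omega
  obtain ⟨v, hstep, hclose, hv⟩ := exists_seq_of_weightedGram_mulVec_eq_zero hx1 ha
  have hv0 : W.mulVec (v 0) i = 0 := by simpa using hv 0 hK
  have hvle : ∀ j ≤ γ.length, W.mulVec (v j) (γ.getVert j) = 0 := by
    intro j hj
    rcases hj.lt_or_eq with hj | rfl
    · exact hv j hj
    · rw [hclose, Matrix.mulVec_smul, Pi.smul_apply, SimpleGraph.Walk.getVert_length, hv0,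
        smul_zero]
  have htr := transport_eq_of_forall_step hW γ v hvle fun j _ => ⟨a j, hstep j⟩
  obtain ⟨s, hs⟩ := transport_sub_transport_of_homotopic hW hdiag hγ hv0
  have hnil : transport W (SimpleGraph.Walk.nil : G.Walk i i) (v 0) = v 0 := rfl
  rw [htr, hnil] at hs
  obtain ⟨m, hm⟩ : ∃ m, γ.length = m + 1 := ⟨γ.length - 1, by omega⟩
  have hadj : G.Adj (γ.getVert m) i := by
    have := γ.adj_getVert_succ (i := m) (by omega)
    rwa [← hm, SimpleGraph.Walk.getVert_length] at this
  have hlast : W.mulVec (v 0) (γ.getVert m) = 0 := by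
    have h1 : W.mulVec (v γ.length) (γ.getVert m) = 0 := by
      rw [hm, hstep, mulVec_add_smul_single, hv m (by omega), hdiag, mul_zero, add_zero]
    rw [hclose, Matrix.mulVec_smul, Pi.smul_apply, smul_eq_mul] at h1
    exact (mul_eq_zero.1 h1).resolve_left hx0
  have hs0 : s = 0 := by
    refine eq_zero_of_consecutive_mulVec_eq_zero (hW _ _ hadj.symm) (sub_eq_iff_eq_add'.1 hs)
      hlast ?_
    rw [hclose, Matrix.mulVec_smul, Pi.smul_apply, hlast, smul_zero]
  have hv00 : v 0 = 0 := by
    rw [hs0, zero_smul, hclose, sub_eq_zero] at hs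
    have : (x - 1) • v 0 = 0 := by rw [sub_smul, one_smul, hs, sub_self]
    exact (smul_eq_zero.1 this).resolve_left (sub_ne_zero.2 hx1)
  have hcoeff : ∀ j < γ.length, v j = 0 → a j = 0 := by
    intro j hj h0
    refine eq_zero_of_consecutive_mulVec_eq_zero (hW _ _ (γ.adj_getVert_succ hj)) (hstep j) ?_
      (hvle (j + 1) hj)
    rw [h0, Matrix.mulVec_zero, Pi.zero_apply]
  have hzero : ∀ j ≤ γ.length, v j = 0 := by
    intro j
    induction j with
    | zero => exact fun _ => hv00
    | succ j ih =>
      intro hj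
      rw [hstep, ih (by omega), hcoeff j (by omega) (ih (by omega)), zero_smul, add_zero]
  exact fun j hj => hcoeff j hj (hzero j hj.le)

/-- If every vector in the two hyperplanes of an edge is in the kernel (as for matrices of rank
two), the weighted matrix of pairings is singular at most at `x = 0` and `x = 1`. -/
theorem det_weightedGram_ne_zero_of_ker {W : Matrix ι ι F} {G : SimpleGraph ι}
    (hW : ∀ u v, G.Adj u v → W v u ≠ 0) (hdiag : ∀ u, W u u = 0)
    (hker : ∀ u v, G.Adj u v → ∀ y, W.mulVec y u = 0 → W.mulVec y v = 0 → W.mulVec y = 0)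
    {i : ι} (γ : G.Walk i i) {x : F} (hx0 : x ≠ 0) (hx1 : x ≠ 1) :
    (weightedGram W γ.getVert γ.length x).det ≠ 0 := by
  refine det_weightedGram_ne_zero_of_forall fun a ha => ?_
  obtain ⟨v, hstep, hclose, hv⟩ := exists_seq_of_weightedGram_mulVec_eq_zero hx1 ha
  have hvle : ∀ j ≤ γ.length, W.mulVec (v j) (γ.getVert j) = 0 := by
    intro j hj
    rcases hj.lt_or_eq with hj | rfl
    · exact hv j hj
    · rcases Nat.eq_zero_or_pos γ.length with hK | hK
      · have h0 : v 0 = 0 := by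
          rw [hK] at hclose
          have : (x - 1) • v 0 = 0 := by rw [sub_smul, one_smul, ← hclose, sub_self]
          exact (smul_eq_zero.1 this).resolve_left (sub_ne_zero.2 hx1)
        simp [hK, h0]
      · have := hv 0 hK
        rw [SimpleGraph.Walk.getVert_zero] at this
        rw [hclose, Matrix.mulVec_smul, Pi.smul_apply, SimpleGraph.Walk.getVert_length, this,
          smul_zero]
  have hsucc : ∀ j < γ.length, W.mulVec (v (j + 1)) = 0 := by
    intro j hj
    refine hker _ _ (γ.adj_getVert_succ hj) _ ?_ (hvle (j + 1) hj)
    rw [hstep, mulVec_add_smul_single, hv j hj, hdiag, mul_zero, add_zero]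
  intro j hj
  have hj0 : W.mulVec (v j) = 0 := by
    cases j with
    | zero =>
      have h1 := hsucc (γ.length - 1) (by omega)
      rw [Nat.sub_add_cancel hj, hclose, Matrix.mulVec_smul] at h1
      exact (smul_eq_zero.1 h1).resolve_left hx0
    | succ j => exact hsucc j (by omega)
  exact eq_zero_of_consecutive_mulVec_eq_zero (hW _ _ (γ.adj_getVert_succ hj)) (hstep j)
    (congrFun hj0 _) (hvle (j + 1) hj)

/-- For a matrix of rank two, a vector orthogonal to the two rows of an edge is in the kernel: these
rows are linearly independent, hence span the row space. -/
theorem mulVec_eq_zero_of_rank_eq_two {n : ℕ} (A : space n) (hrank : A.1.rank = 2) {u v : Fin n}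
    (huv : 0 < A.1 u v) {y : Fin n → ℂ} (hu : (A.1.map ((↑) : ℝ → ℂ)).mulVec y u = 0)
    (hv : (A.1.map ((↑) : ℝ → ℂ)).mulVec y v = 0) : (A.1.map ((↑) : ℝ → ℂ)).mulVec y = 0 := by
  have hvu : 0 < A.1 v u := by rwa [A.2.1.apply]
  have hli : LinearIndependent ℝ ![A.1 u, A.1 v] := by
    rw [LinearIndependent.pair_iff]
    intro s t h
    have h1 := congrFun h u
    have h2 := congrFun h v
    simp only [Pi.add_apply, Pi.smul_apply, smul_eq_mul, A.2.2.2, mul_zero, zero_add, add_zero,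
      Pi.zero_apply, mul_eq_zero, huv.ne', hvu.ne', or_false] at h1 h2
    exact ⟨h2, h1⟩
  have hle : Submodule.span ℝ (Set.range ![A.1 u, A.1 v]) ≤
      Submodule.span ℝ (Set.range A.1.row) := by
    refine Submodule.span_mono ?_
    rintro _ ⟨j, rfl⟩
    fin_cases j
    · exact ⟨u, rfl⟩
    · exact ⟨v, rfl⟩
  have heq := Submodule.eq_of_le_of_finrank_eq hle (by
    rw [finrank_span_eq_card hli, ← Matrix.rank_eq_finrank_span_row, hrank, Fintype.card_fin])
  ext w
  have hw : A.1 w ∈ Submodule.span ℝ (Set.range ![A.1 u, A.1 v]) := by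
    rw [heq]
    exact Submodule.subset_span ⟨w, rfl⟩
  rw [Matrix.range_cons, Matrix.range_cons, Matrix.range_empty, Set.union_empty,
    Set.singleton_union, Submodule.mem_span_pair] at hw
  obtain ⟨s, t, hst⟩ := hw
  have hlin : (A.1.map ((↑) : ℝ → ℂ)).mulVec y w = s * (A.1.map ((↑) : ℝ → ℂ)).mulVec y u +
      t * (A.1.map ((↑) : ℝ → ℂ)).mulVec y v := by
    simp only [Matrix.mulVec, dotProduct, Matrix.map_apply, Finset.mul_sum,
      ← Finset.sum_add_distrib, ← hst, Pi.add_apply, Pi.smul_apply, smul_eq_mul]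
    refine Finset.sum_congr rfl fun b _ => ?_
    push_cast
    ring
  rw [hlin, hu, hv, mul_zero, mul_zero, add_zero, Pi.zero_apply]

end NullVector

/-! ### Polynomials with one root tending to infinity -/

open Polynomial in
/-- Pointwise convergence of polynomials of bounded degree at all points `x > 1` implies convergence
of the coefficients, by Lagrange interpolation. -/
theorem exists_tendsto_coeff_of_tendsto_eval {f : ℕ → ℝ[X]} {N : ℕ}
    (hdeg : ∀ k, (f k).natDegree ≤ N)
    (h : ∀ x : ℝ, 1 < x → ∃ y, Tendsto (fun k => (f k).eval x) atTop (𝓝 y)) :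
    ∃ ℓ : ℝ[X], ∀ j, Tendsto (fun k => (f k).coeff j) atTop (𝓝 (ℓ.coeff j)) := by
  have hnode : ∀ i : ℕ, (1 : ℝ) < i + 2 := fun i => by
    have : (0 : ℝ) ≤ i := Nat.cast_nonneg i
    linarith
  choose y hy using fun i : ℕ => h (i + 2) (hnode i)
  set v : ℕ → ℝ := fun i => i + 2 with hv
  have hinj : Set.InjOn v (Finset.range (N + 1)) := by
    intro a _ b _ hab
    simpa [hv] using hab
  have hf : ∀ k, f k = ∑ i ∈ Finset.range (N + 1),
      C ((f k).eval (v i)) * Lagrange.basis (Finset.range (N + 1)) v i := by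
    intro k
    conv_lhs => rw [Lagrange.eq_interpolate (f := f k) hinj (by
      rw [Finset.card_range]
      exact degree_le_natDegree.trans_lt (by exact_mod_cast Nat.lt_succ_of_le (hdeg k)))]
    rw [Lagrange.interpolate_apply]
  refine ⟨∑ i ∈ Finset.range (N + 1), C (y i) * Lagrange.basis (Finset.range (N + 1)) v i,
    fun j => ?_⟩
  have hfj : ∀ k, (f k).coeff j = ∑ i ∈ Finset.range (N + 1),
      (f k).eval (v i) * (Lagrange.basis (Finset.range (N + 1)) v i).coeff j := by
    intro k
    conv_lhs => rw [hf k]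
    simp only [finsetSum_coeff, coeff_C_mul]
  simp only [hfj, finsetSum_coeff, coeff_C_mul]
  exact tendsto_finsetSum _ fun i _ => (hy i).mul_const _

open Polynomial in
theorem tendsto_aeval_of_tendsto_coeff {A : Type*} [NormedRing A] [NormedAlgebra ℝ A]
    {f : ℕ → ℝ[X]} {ℓ : ℝ[X]} {N : ℕ}
    (hf : ∀ k, (f k).natDegree ≤ N) (hℓ : ℓ.natDegree ≤ N)
    (h : ∀ j, Tendsto (fun k => (f k).coeff j) atTop (𝓝 (ℓ.coeff j))) (z : A) :
    Tendsto (fun k => aeval z (f k)) atTop (𝓝 (aeval z ℓ)) := by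
  simp only [aeval_eq_sum_range' (Nat.lt_succ_of_le (hf _)),
    aeval_eq_sum_range' (Nat.lt_succ_of_le hℓ)]
  exact tendsto_finsetSum _ fun j _ => (h j).smul_const _

open Polynomial in
theorem norm_le_of_aeval_eq_zero {S : ℝ[X]} (hS : S.Monic) {z : ℂ} (hz : aeval z S = 0) :
    ‖z‖ ≤ 1 + ∑ j ∈ Finset.range S.natDegree, ‖S.coeff j‖ := by
  by_contra! hlt
  have hnn : 0 ≤ ∑ j ∈ Finset.range S.natDegree, ‖S.coeff j‖ :=
    Finset.sum_nonneg fun _ _ => norm_nonneg _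
  have h1 : 1 ≤ ‖z‖ := by linarith
  rcases Nat.eq_zero_or_eq_succ_pred S.natDegree with hd | hd
  · rw [hS.natDegree_eq_zero.1 hd] at hz
    simp at hz
  · set d := S.natDegree.pred
    rw [aeval_eq_sum_range, Finset.sum_range_succ, hS.coeff_natDegree, one_smul] at hz
    have h2 : ‖z‖ ^ S.natDegree ≤ (∑ j ∈ Finset.range S.natDegree, ‖S.coeff j‖) * ‖z‖ ^ d := by
      rw [← norm_pow, ← norm_neg, ← eq_neg_of_add_eq_zero_left hz, Finset.sum_mul]
      refine (norm_sum_le _ _).trans (Finset.sum_le_sum fun j hj => ?_)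
      rw [norm_smul, norm_pow]
      refine mul_le_mul_of_nonneg_left (pow_le_pow_right₀ h1 ?_) (norm_nonneg _)
      have := Finset.mem_range.1 hj
      omega
    have hpos : 0 < ‖z‖ ^ d := by positivity
    nth_rw 1 [hd] at h2
    rw [Nat.succ_eq_add_one, pow_succ'] at h2
    have := le_of_mul_le_mul_right h2 hpos
    linarith

open Polynomial in
/-- Continuity of roots: if the coefficients of monic polynomials converge, then their complex
roots eventually lie in any given neighbourhood of the roots of the limit. -/
theorem eventually_forall_root_mem {S : ℕ → ℝ[X]} {σ : ℝ[X]} {d : ℕ}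
    (hS : ∀ᶠ k in atTop, (S k).Monic ∧ (S k).natDegree = d) (hσ : σ.natDegree ≤ d)
    (h : ∀ j, Tendsto (fun k => (S k).coeff j) atTop (𝓝 (σ.coeff j)))
    {U : Set ℂ} (hU : IsOpen U) (hroot : ∀ z : ℂ, aeval z σ = 0 → z ∈ U) :
    ∀ᶠ k in atTop, ∀ z : ℂ, aeval z (S k) = 0 → z ∈ U := by
  set B : ℝ := 1 + ∑ j ∈ Finset.range d, ‖σ.coeff j‖ + 1 with hB
  have hbound : ∀ᶠ k in atTop, 1 + ∑ j ∈ Finset.range d, ‖(S k).coeff j‖ < B := by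
    have : Tendsto (fun k => 1 + ∑ j ∈ Finset.range d, ‖(S k).coeff j‖) atTop
        (𝓝 (1 + ∑ j ∈ Finset.range d, ‖σ.coeff j‖)) :=
      (tendsto_finsetSum _ fun j _ => (h j).norm).const_add _
    exact this.eventually_lt_const (by linarith)
  have hcomp : IsCompact (Metric.closedBall (0 : ℂ) B \ U) := (isCompact_closedBall 0 B).diff hU
  have hcoeff : Tendsto (fun k => fun j : Fin (d + 1) => (S k).coeff j) atTop
      (𝓝 fun j : Fin (d + 1) => σ.coeff j) := tendsto_pi_nhds.2 fun j => h j
  have heval : ∀ p : ℝ[X], p.natDegree ≤ d → ∀ z : ℂ,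
      aeval z p = ∑ j : Fin (d + 1), (p.coeff j) • z ^ (j : ℕ) := by
    intro p hp z
    rw [aeval_eq_sum_range' (Nat.lt_succ_of_le hp), Finset.sum_range]
  have hopen : IsOpen {q : (Fin (d + 1) → ℝ) × ℂ | ∑ j, q.1 j • q.2 ^ (j : ℕ) ≠ 0} :=
    isOpen_ne_fun (by fun_prop) continuous_const
  have hev := hcomp.eventually_forall_of_forall_eventually
    (x₀ := fun j : Fin (d + 1) => σ.coeff j)
    (P := fun c z => ∑ j, c j • z ^ (j : ℕ) ≠ 0) (by
      intro z hz
      refine hopen.mem_nhds (x := (_, z)) ?_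
      change ∑ j : Fin (d + 1), σ.coeff j • z ^ (j : ℕ) ≠ 0
      rw [← heval σ hσ]
      exact fun h0 => hz.2 (hroot z h0))
  filter_upwards [hcoeff.eventually hev, hbound, hS] with k hk hkB hkS z hz
  by_contra hzU
  refine hk z ⟨?_, hzU⟩ ?_
  · rw [mem_closedBall_zero_iff]
    have := norm_le_of_aeval_eq_zero hkS.1 hz
    rw [hkS.2] at this
    linarith
  · rw [← heval _ hkS.2.le, hz]

section LargeRoot

open Polynomial

variable {f : ℕ → ℝ[X]} {ℓ : ℝ[X]} {N : ℕ} {T : ℕ → ℝ}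

/-- If the rescaled monic polynomials converge to a polynomial of smaller degree with negative
leading coefficient, then they have arbitrarily large real roots. -/
theorem eventually_exists_isRoot_gt (hf : ∀ k, (f k).Monic ∧ (f k).natDegree = N + 1)
    (hN : 0 < N) (hT : Tendsto T atTop atTop) (hℓ : ℓ.natDegree ≤ N) (hneg : ℓ.coeff N < 0)
    (hlim : ∀ j, Tendsto (fun k => (T k)⁻¹ * (f k).coeff j) atTop (𝓝 (ℓ.coeff j))) (R : ℝ) :
    ∀ᶠ k in atTop, ∃ x, R < x ∧ (f k).IsRoot x := by
  have hdeg : ℓ.natDegree = N := le_antisymm hℓ (le_natDegree_of_ne_zero hneg.ne)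
  have hbot := ℓ.tendsto_atBot_of_leadingCoeff_nonpos
    (natDegree_pos_iff_degree_pos.1 (hdeg ▸ hN)) (by rw [leadingCoeff, hdeg]; exact hneg.le)
  obtain ⟨x₀, hx₀, hRx⟩ := ((hbot.eventually_lt_atBot 0).and (eventually_gt_atTop R)).exists
  have hev := tendsto_aeval_of_tendsto_coeff (f := fun k => C (T k)⁻¹ * f k) (N := N + 1)
    (fun k => (natDegree_C_mul_le _ _).trans (hf k).2.le) (hℓ.trans N.le_succ)
    (by simpa only [coeff_C_mul] using hlim) x₀
  simp only [coe_aeval_eq_eval, eval_mul, eval_C] at hev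
  filter_upwards [hev.eventually_lt_const hx₀, hT.eventually_gt_atTop 0] with k hk hTk
  have hfx : (f k).eval x₀ < 0 := by
    by_contra! hcon
    exact absurd hk (not_lt.2 (mul_nonneg (inv_nonneg.2 hTk.le) hcon))
  have htop := (f k).tendsto_atTop_of_leadingCoeff_nonneg
    (natDegree_pos_iff_degree_pos.1 ((hf k).2 ▸ N.succ_pos)) (by rw [(hf k).1.leadingCoeff]; simp)
  obtain ⟨x₁, hx₁, hx01⟩ := ((htop.eventually_ge_atTop 0).and (eventually_ge_atTop x₀)).exists
  obtain ⟨x, hx, hx0⟩ := intermediate_value_Icc hx01 (f k).continuous.continuousOn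
    ⟨hfx.le, hx₁⟩
  exact ⟨x, hRx.trans_le hx.1, hx0⟩

/-- A root tending to infinity is asymptotic to the sum of the roots. -/
theorem tendsto_div_of_isRoot (hf : ∀ k, (f k).Monic ∧ (f k).natDegree = N + 1)
    (hlim : ∀ j, Tendsto (fun k => (T k)⁻¹ * (f k).coeff j) atTop (𝓝 (ℓ.coeff j)))
    {x : ℕ → ℝ} (hx : Tendsto x atTop atTop) (hroot : ∀ᶠ k in atTop, (f k).IsRoot (x k)) :
    Tendsto (fun k => (T k)⁻¹ * x k) atTop (𝓝 (-ℓ.coeff N)) := by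
  have hterm : ∀ j < N, Tendsto (fun k => (T k)⁻¹ * (f k).coeff j * (x k ^ (N - j))⁻¹) atTop
      (𝓝 (ℓ.coeff j * 0)) := fun j hj =>
    (hlim j).mul ((tendsto_pow_atTop (by omega)).comp hx).inv_tendsto_atTop
  have hsum : Tendsto (fun k => -((∑ j ∈ Finset.range N,
      (T k)⁻¹ * (f k).coeff j * (x k ^ (N - j))⁻¹) + (T k)⁻¹ * (f k).coeff N)) atTop
      (𝓝 (-((∑ j ∈ Finset.range N, ℓ.coeff j * 0) + ℓ.coeff N))) :=
    ((tendsto_finsetSum _ fun j hj => hterm j (Finset.mem_range.1 hj)).add (hlim N)).neg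
  simp only [mul_zero, Finset.sum_const_zero, zero_add] at hsum
  refine hsum.congr' ?_
  filter_upwards [hroot, hx.eventually_gt_atTop 0] with k hk hxk
  have h0 : (f k).eval (x k) = 0 := hk
  rw [eval_eq_sum_range, (hf k).2, Finset.sum_range_succ, ← (hf k).2, (hf k).1.coeff_natDegree,
    (hf k).2, Finset.sum_range_succ, one_mul] at h0
  have hpow : x k ^ N ≠ 0 := by positivity
  have hx1 : x k = -((∑ j ∈ Finset.range N, (f k).coeff j * (x k ^ (N - j))⁻¹) +
      (f k).coeff N) := by
    have h2 : ∑ j ∈ Finset.range N, (f k).coeff j * x k ^ j =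
        (∑ j ∈ Finset.range N, (f k).coeff j * (x k ^ (N - j))⁻¹) * x k ^ N := by
      rw [Finset.sum_mul]
      refine Finset.sum_congr rfl fun j hj => ?_
      have hj := Finset.mem_range.1 hj
      have h3 : x k ^ N = x k ^ (N - j) * x k ^ j := by rw [← pow_add]; congr 1; omega
      have h4 : x k ^ (N - j) ≠ 0 := by positivity
      rw [h3, mul_assoc, inv_mul_cancel_left₀ h4]
    rw [h2, pow_succ', ← add_mul, ← add_mul] at h0
    have := (mul_eq_zero.1 h0).resolve_right hpow
    linarith
  conv_rhs => rw [hx1]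
  rw [mul_neg, mul_add, Finset.mul_sum]
  simp only [mul_assoc]

/-- The cofactor of a root tending to infinity converges to the normalized limit polynomial. -/
theorem tendsto_coeff_cofactor (hf : ∀ k, (f k).Monic ∧ (f k).natDegree = N + 1)
    (hneg : ℓ.coeff N < 0)
    (hlim : ∀ j, Tendsto (fun k => (T k)⁻¹ * (f k).coeff j) atTop (𝓝 (ℓ.coeff j)))
    (hT : Tendsto T atTop atTop)
    {x : ℕ → ℝ} (hx : Tendsto x atTop atTop) {S : ℕ → ℝ[X]}
    (hS : ∀ᶠ k in atTop, f k = (X - C (x k)) * S k) (j : ℕ) :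
    Tendsto (fun k => (S k).coeff j) atTop (𝓝 ((C (ℓ.coeff N)⁻¹ * ℓ).coeff j)) := by
  have hroot : ∀ᶠ k in atTop, (f k).IsRoot (x k) := hS.mono fun k hk => by
    rw [hk]; simp
  have hTx := tendsto_div_of_isRoot hf hlim hx hroot
  have hquot : ∀ j, Tendsto (fun k => (f k).coeff j / x k) atTop
      (𝓝 (-((C (ℓ.coeff N)⁻¹ * ℓ).coeff j))) := by
    intro j
    have h := (hlim j).div hTx (neg_ne_zero.2 hneg.ne)
    have he : ℓ.coeff j / -ℓ.coeff N = -((C (ℓ.coeff N)⁻¹ * ℓ).coeff j) := by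
      rw [coeff_C_mul, div_neg, div_eq_inv_mul]
    rw [he] at h
    refine h.congr' ?_
    filter_upwards [hT.eventually_gt_atTop 0] with k hk
    exact mul_div_mul_left _ _ (inv_ne_zero hk.ne')
  induction j with
  | zero =>
    have h := (hquot 0).neg
    rw [neg_neg] at h
    refine h.congr' ?_
    filter_upwards [hS, hx.eventually_gt_atTop 0] with k hk hxk
    rw [hk, mul_coeff_zero]
    simp only [coeff_sub, coeff_X_zero, coeff_C_zero, zero_sub]
    field_simp
  | succ j ih =>
    have h := (ih.mul hx.inv_tendsto_atTop).sub (hquot (j + 1))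
    rw [mul_zero, zero_sub, neg_neg] at h
    refine h.congr' ?_
    filter_upwards [hS, hx.eventually_gt_atTop 0] with k hk hxk
    rw [hk, sub_mul, coeff_sub, coeff_X_mul, coeff_C_mul, Pi.inv_apply]
    field_simp
    ring

/-- If the rescaled monic polynomials converge to a polynomial of smaller degree with negative
leading coefficient and without complex roots besides `0` and `1`, then the largest real root
tends to infinity while the remaining complex roots (counted with multiplicity) accumulate only
at `0` and `1`. -/
theorem eventually_exists_greatest_root (hf : ∀ k, (f k).Monic ∧ (f k).natDegree = N + 1)
    (hN : 0 < N) (hT : Tendsto T atTop atTop) (hℓ : ℓ.natDegree ≤ N) (hneg : ℓ.coeff N < 0)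
    (hlim : ∀ j, Tendsto (fun k => (T k)⁻¹ * (f k).coeff j) atTop (𝓝 (ℓ.coeff j)))
    (hℓroot : ∀ z : ℂ, aeval z ℓ = 0 → z = 0 ∨ z = 1) {ε : ℝ} (hε : 0 < ε) :
    ∀ᶠ k in atTop, ∃ x, 1 < x ∧ IsGreatest {y | (f k).IsRoot y} x ∧
      ∃ S : ℝ[X], f k = (X - C x) * S ∧ ∀ z : ℂ, aeval z S = 0 → ‖z‖ < ε ∨ ‖1 - z‖ < ε := by
  have hlarge := eventually_exists_isRoot_gt hf hN hT hℓ hneg hlim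
  have hgreat : ∀ k, (∃ x, (f k).IsRoot x) → ∃ x, IsGreatest {y | (f k).IsRoot y} x := by
    rintro k ⟨x, hx⟩
    have hfin : {y | (f k).IsRoot y}.Finite := finite_setOfPred_isRoot (hf k).1.ne_zero
    obtain ⟨y, hy, hmax⟩ := hfin.exists_maximal ⟨x, hx⟩
    exact ⟨y, hy, fun z hz => (le_total z y).elim id fun h => hmax hz h⟩
  have : ∀ k, ∃ x, (∃ x, (f k).IsRoot x) → IsGreatest {y | (f k).IsRoot y} x := fun k => by
    by_cases h : ∃ x, (f k).IsRoot x
    · exact (hgreat k h).imp fun x hx _ => hx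
    · exact ⟨0, fun h' => absurd h' h⟩
  choose x hx using this
  have hxgt : ∀ R, ∀ᶠ k in atTop, R < x k ∧ IsGreatest {y | (f k).IsRoot y} (x k) := fun R => by
    filter_upwards [hlarge R] with k hk
    obtain ⟨y, hRy, hy⟩ := hk
    have hg := hx k ⟨y, hy⟩
    exact ⟨hRy.trans_le (hg.2 hy), hg⟩
  have hxtop : Tendsto x atTop atTop := tendsto_atTop.2 fun R => (hxgt R).mono fun k hk => hk.1.le
  have hS : ∀ k, ∃ S : ℝ[X], (f k).IsRoot (x k) → f k = (X - C (x k)) * S := fun k => by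
    by_cases h : (f k).IsRoot (x k)
    · exact (dvd_iff_isRoot.2 h).imp fun S hS _ => hS
    · exact ⟨0, fun h' => absurd h' h⟩
  choose S hS using hS
  have hS' : ∀ᶠ k in atTop, f k = (X - C (x k)) * S k :=
    (hxgt 0).mono fun k hk => hS k hk.2.1
  have hSm : ∀ᶠ k in atTop, (S k).Monic ∧ (S k).natDegree = N := hS'.mono fun k hk => by
    have hm : (S k).Monic := (monic_X_sub_C (x k)).of_mul_monic_left (hk ▸ (hf k).1)
    refine ⟨hm, ?_⟩
    have := (monic_X_sub_C (x k)).natDegree_mul hm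
    rw [← hk, (hf k).2, natDegree_X_sub_C] at this
    omega
  have hroots := eventually_forall_root_mem (σ := C (ℓ.coeff N)⁻¹ * ℓ) hSm
    ((natDegree_C_mul_le _ _).trans hℓ)
    (tendsto_coeff_cofactor hf hneg hlim hT hxtop hS')
    (U := {z : ℂ | ‖z‖ < ε} ∪ {z : ℂ | ‖1 - z‖ < ε})
    ((isOpen_lt (by fun_prop) continuous_const).union (isOpen_lt (by fun_prop) continuous_const))
    (by
      intro z hz
      rw [map_mul, aeval_C] at hz
      have hz := (mul_eq_zero.1 hz).resolve_left (by simpa using hneg.ne)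
      rcases hℓroot z hz with rfl | rfl
      · left; simpa using hε
      · right; simpa using hε)
  filter_upwards [hroots, hS', hxgt 1] with k h1 h2 h3
  exact ⟨x k, h3.1, h3.2, S k, h2, h1⟩

end LargeRoot

/-! ### The quadratic form and the multiplicity of the eigenvalue one -/

section QuadraticForm

variable {ι : Type} [Fintype ι] [DecidableEq ι]

theorem mulVec_one_add_smul_diagonal_mul {R : Type*} [CommRing R] (W : Matrix ι ι R) (g : ι)
    (c : R) (y : ι → R) :
    (1 + c • (Matrix.diagonal (Pi.single g (1 : R)) * W)).mulVec y =
      y + (c * W.mulVec y g) • Pi.single g 1 := by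
  rw [Matrix.add_mulVec, Matrix.one_mulVec, Matrix.smul_mulVec, ← Matrix.mulVec_mulVec, mul_smul]
  congr 2
  ext a
  rw [Matrix.mulVec_diagonal, Pi.smul_apply, Pi.single_apply]
  split_ifs with h
  · subst h; simp
  · simp

/-- The factor `I + c D_g W` increases the quadratic form of `W` by `2 c ((W y)_g)²`. -/
theorem dotProduct_mulVec_add_smul_single {W : Matrix ι ι ℝ} (hW : W.IsSymm) {g : ι}
    (hg : W g g = 0) (c : ℝ) (y : ι → ℝ) :
    (y + (c * W.mulVec y g) • Pi.single g 1) ⬝ᵥ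
        W.mulVec (y + (c * W.mulVec y g) • Pi.single g 1) =
      y ⬝ᵥ W.mulVec y + 2 * c * W.mulVec y g ^ 2 := by
  set s := c * W.mulVec y g with hs
  have hcol : y ⬝ᵥ W.mulVec (Pi.single g 1) = W.mulVec y g := by
    rw [Matrix.dotProduct_mulVec, ← Matrix.mulVec_transpose, hW.eq, dotProduct_single, mul_one]
  have hgg : W.mulVec (Pi.single g 1) g = 0 := by simpa using hg
  rw [Matrix.mulVec_add, Matrix.mulVec_smul, add_dotProduct, dotProduct_add, dotProduct_add,
    smul_dotProduct, smul_dotProduct, dotProduct_smul, dotProduct_smul, single_one_dotProduct,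
    single_one_dotProduct, hcol, hgg]
  simp only [smul_eq_mul, hs]
  ring

variable {W : Matrix ι ι ℝ} {g : ℕ → ι} {c : ℕ → ℝ}

theorem orderedProd_mulVec_of_mulVec_eq_zero {y : ι → ℝ} (hy : W.mulVec y = 0) (K : ℕ) :
    (orderedProd (fun j => 1 + c j • (Matrix.diagonal (Pi.single (g j) (1 : ℝ)) * W)) K).mulVec y =
      y := by
  induction K with
  | zero => simp [orderedProd]
  | succ K ih =>
    rw [orderedProd, ← Matrix.mulVec_mulVec, ih, mulVec_one_add_smul_diagonal_mul, hy]
    simp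

/-- The quadratic form of `W` increases strictly along the product outside the kernel of `W`,
provided that all factors appear. -/
theorem mulVec_eq_zero_of_dotProduct_eq (hW : W.IsSymm) (hdiag : ∀ a, W a a = 0)
    (hc : ∀ j, 0 < c j) {K : ℕ} (hg : ∀ a, ∃ j < K, g j = a) {y : ι → ℝ}
    (hy : (orderedProd (fun j => 1 + c j • (Matrix.diagonal (Pi.single (g j) (1 : ℝ)) * W))
        K).mulVec y ⬝ᵥ W.mulVec ((orderedProd (fun j => 1 + c j •
          (Matrix.diagonal (Pi.single (g j) (1 : ℝ)) * W)) K).mulVec y) = y ⬝ᵥ W.mulVec y) :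
    W.mulVec y = 0 := by
  set M := orderedProd fun j => 1 + c j • (Matrix.diagonal (Pi.single (g j) (1 : ℝ)) * W) with hM
  set φ : ℕ → ℝ := fun j => (M j).mulVec y ⬝ᵥ W.mulVec ((M j).mulVec y) with hφ
  have hM0 : (M 0).mulVec y = y := by simp [hM, orderedProd]
  have hMs : ∀ j, (M (j + 1)).mulVec y =
      (M j).mulVec y + (c j * W.mulVec ((M j).mulVec y) (g j)) • Pi.single (g j) 1 := fun j => by
    rw [← mulVec_one_add_smul_diagonal_mul, Matrix.mulVec_mulVec, hM, orderedProd]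
  have hφs : ∀ j, φ (j + 1) = φ j + 2 * c j * W.mulVec ((M j).mulVec y) (g j) ^ 2 := fun j => by
    simp only [hφ]
    rw [hMs, dotProduct_mulVec_add_smul_single hW (hdiag _)]
  have hmono : Monotone φ := monotone_nat_of_le_succ fun j => by
    rw [hφs]
    have := (hc j).le
    have := sq_nonneg (W.mulVec ((M j).mulVec y) (g j))
    have : 0 ≤ 2 * c j * W.mulVec ((M j).mulVec y) (g j) ^ 2 := by positivity
    linarith
  have hends : φ K = φ 0 := by
    simp only [hφ, hM0]
    exact hy
  have hzero : ∀ j < K, W.mulVec ((M j).mulVec y) (g j) = 0 := fun j hj => by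
    have h1 := hmono (Nat.zero_le j)
    have h2 := hmono (show j + 1 ≤ K from hj)
    have h3 := hφs j
    have hcj := hc j
    have h4 : 2 * c j * W.mulVec ((M j).mulVec y) (g j) ^ 2 ≤ 0 := by linarith
    have h5 : W.mulVec ((M j).mulVec y) (g j) ^ 2 ≤ 0 := by
      by_contra! hcon
      have : 0 < 2 * c j * W.mulVec ((M j).mulVec y) (g j) ^ 2 := by positivity
      linarith
    exact pow_eq_zero_iff two_ne_zero |>.1 (le_antisymm h5 (sq_nonneg _))
  have hfix : ∀ j ≤ K, (M j).mulVec y = y := by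
    intro j
    induction j with
    | zero => exact fun _ => hM0
    | succ j ih =>
      intro hj
      rw [hMs, hzero j hj, mul_zero, zero_smul, add_zero, ih (by omega)]
  ext a
  obtain ⟨j, hj, rfl⟩ := hg a
  have := hzero j hj
  rwa [hfix j hj.le] at this

/-- If all factors appear, the generalized eigenspace of the product for the eigenvalue `1` is the
kernel of `W`, so that the algebraic multiplicity of `1` is the corank of `W`. -/
theorem rootMultiplicity_one_charpoly_add_rank (hW : W.IsSymm) (hdiag : ∀ a, W a a = 0)
    (hc : ∀ j, 0 < c j) {K : ℕ} (hg : ∀ a, ∃ j < K, g j = a) :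
    (orderedProd (fun j => 1 + c j • (Matrix.diagonal (Pi.single (g j) (1 : ℝ)) * W))
      K).charpoly.rootMultiplicity 1 + W.rank = Fintype.card ι := by
  set M := orderedProd (fun j => 1 + c j • (Matrix.diagonal (Pi.single (g j) (1 : ℝ)) * W)) K
    with hM
  have hle : ∀ (m : ℕ) (y : ι → ℝ), ((Matrix.toLin' M - 1) ^ m) y = 0 → W.mulVec y = 0 := by
    intro m
    induction m with
    | zero =>
      intro y hy
      have hy : y = 0 := hy
      simp [hy]
    | succ m ih =>
      intro y hy
      rw [pow_succ, Module.End.mul_apply] at hy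
      have h1 := ih _ hy
      rw [LinearMap.sub_apply, Matrix.toLin'_apply, Module.End.one_apply] at h1
      refine mulVec_eq_zero_of_dotProduct_eq hW hdiag hc hg (y := y) ?_
      rw [← hM]
      have h2 : W.mulVec (M.mulVec y) = W.mulVec y := by
        rw [← sub_eq_zero, ← Matrix.mulVec_sub, h1]
      rw [h2, Matrix.dotProduct_mulVec, ← Matrix.mulVec_transpose, hW.eq, h2,
        dotProduct_comm]
  have heq : Module.End.maxGenEigenspace (Matrix.toLin' M) 1 = LinearMap.ker W.mulVecLin := by
    ext y
    rw [Module.End.mem_maxGenEigenspace, LinearMap.mem_ker, Matrix.mulVecLin_apply, one_smul]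
    constructor
    · rintro ⟨m, hm⟩
      exact hle m y hm
    · intro hy
      refine ⟨1, ?_⟩
      rw [pow_one, LinearMap.sub_apply, Matrix.toLin'_apply, Module.End.one_apply, hM,
        orderedProd_mulVec_of_mulVec_eq_zero hy, sub_self]
  have h1 := LinearMap.finrank_maxGenEigenspace_eq (Matrix.toLin' M) 1
  have h2 := W.mulVecLin.finrank_range_add_finrank_ker
  rw [heq, Matrix.charpoly_toLin'] at h1
  rw [Module.finrank_fintype_fun_eq_card] at h2
  rw [← h1, ← h2, add_comm]
  rfl

end QuadraticForm

/-! ### Integer polynomials with roots near zero and one -/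

section Arithmetic

open Polynomial

theorem norm_multiset_prod_le_pow {C : ℝ} (s : Multiset ℂ) (h : ∀ z ∈ s, ‖z‖ ≤ C) :
    ‖s.prod‖ ≤ C ^ s.card := by
  induction s using Multiset.induction_on with
  | empty => simp
  | cons z s ih =>
    rw [Multiset.prod_cons, norm_mul, Multiset.card_cons, pow_succ']
    have hz := h z (Multiset.mem_cons_self z s)
    exact mul_le_mul hz (ih fun y hy => h y (Multiset.mem_cons_of_mem hy)) (norm_nonneg _)
      ((norm_nonneg _).trans hz)

/-- A monic integer polynomial with constant term `±1`, all of whose roots are close to `0` or `1`,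
has `1` as a root: no root is close to `0` because the product of the roots is `±1`, so the value
at `1` is an integer of absolute value less than one. -/
theorem eval_one_eq_zero_of_roots_near {b : ℤ[X]} (hb : b.Monic) (hdeg : 0 < b.natDegree)
    (hunit : IsUnit (b.eval 0)) {n : ℕ} (hn : b.natDegree ≤ n) {ε : ℝ} (hε : ε * 2 ^ n < 1)
    (hroot : ∀ z : ℂ, aeval z b = 0 → ‖z‖ < ε ∨ ‖1 - z‖ < ε) : b.eval 1 = 0 := by
  set s := b.aroots ℂ with hs
  have heval : ∀ t : ℤ, ((b.eval t : ℤ) : ℂ) = (s.map fun z => (t : ℂ) - z).prod := by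
    intro t
    rw [← (IsAlgClosed.splits _).aeval_eq_prod_aroots_of_monic hb]
    simpa using (aeval_algebraMap_apply ℂ t b).symm
  have hcard : s.card = b.natDegree := by
    rw [hs, aroots_def, ← (IsAlgClosed.splits _).natDegree_eq_card_roots, hb.natDegree_map]
  have hmem : ∀ z ∈ s, ‖z‖ < ε ∨ ‖1 - z‖ < ε := fun z hz => hroot z (mem_aroots.1 hz).2
  have h2n : (1 : ℝ) ≤ 2 ^ n := one_le_pow₀ (by norm_num)
  have hεpos : 0 < ε := by
    obtain ⟨z, hz⟩ := Multiset.card_pos_iff_exists_mem.1 (hcard ▸ hdeg)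
    exact (hmem z hz).elim (norm_nonneg _).trans_lt (norm_nonneg _).trans_lt
  have hε1 : ε < 1 := by nlinarith
  have hfar : ∀ z ∈ s, ‖1 - z‖ < ε := by
    intro z hz
    refine (hmem z hz).resolve_left fun hzε => ?_
    obtain ⟨t, ht⟩ := Multiset.exists_cons_of_mem hz
    have h0 := congrArg norm (heval 0)
    have hle : ∀ y ∈ t.map fun z => ((0 : ℤ) : ℂ) - z, ‖y‖ ≤ 2 := by
      intro y hy
      obtain ⟨w, hw, rfl⟩ := Multiset.mem_map.1 hy
      rw [Int.cast_zero, zero_sub, norm_neg]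
      rcases hmem w (ht ▸ Multiset.mem_cons_of_mem hw) with h | h
      · linarith
      · have := norm_sub_norm_le w 1
        rw [norm_sub_rev, norm_one] at this
        linarith
    have hprod := norm_multiset_prod_le_pow _ hle
    rw [Multiset.card_map] at hprod
    rw [ht, Multiset.map_cons, Multiset.prod_cons, norm_mul] at h0
    have hb0 : ‖((b.eval 0 : ℤ) : ℂ)‖ = 1 := by
      rcases Int.isUnit_iff.1 hunit with h | h <;> simp [h]
    rw [hb0, Int.cast_zero, zero_sub, norm_neg] at h0
    have hpow : (2 : ℝ) ^ t.card ≤ 2 ^ n := by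
      refine pow_le_pow_right₀ (by norm_num) ?_
      rw [ht, Multiset.card_cons] at hcard
      omega
    rw [Int.cast_zero] at hprod
    have := mul_le_mul hzε.le (hprod.trans hpow) (norm_nonneg _) hεpos.le
    linarith
  have h1 := congrArg norm (heval 1)
  have hle : ∀ y ∈ s.map fun z => ((1 : ℤ) : ℂ) - z, ‖y‖ ≤ ε := by
    intro y hy
    obtain ⟨z, hz, rfl⟩ := Multiset.mem_map.1 hy
    rw [Int.cast_one]
    exact (hfar z hz).le
  have hprod := norm_multiset_prod_le_pow _ hle
  rw [← h1, Multiset.card_map, hcard, Complex.norm_intCast, ← Int.cast_abs] at hprod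
  have : |b.eval 1| < 1 := by
    exact_mod_cast hprod.trans_lt (pow_lt_one₀ hεpos.le hε1 hdeg.ne')
  exact Int.abs_lt_one_iff.1 this

/-- A root `x > 1` of a monic integer polynomial of degree `n` with constant term `±1`, all of
whose other roots are close to `0` or `1`, has degree `n` minus the multiplicity of the
root `1`. -/
theorem natDegree_minpoly_eq_of_roots_near {P : ℤ[X]} (hP : P.Monic) (hunit : IsUnit (P.eval 0))
    {ε : ℝ} (hε : ε * 2 ^ P.natDegree < 1) {x : ℝ} (hx : 1 < x) {S : ℝ[X]}
    (hS : P.map (Int.castRingHom ℝ) = (X - C x) * S)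
    (hroot : ∀ z : ℂ, aeval z S = 0 → ‖z‖ < ε ∨ ‖1 - z‖ < ε) :
    IsAlgebraic ℚ x ∧
      (minpoly ℚ x).natDegree + (P.map (Int.castRingHom ℝ)).rootMultiplicity 1 = P.natDegree := by
  have hroot_x : aeval x P = 0 := by
    have : (P.map (Int.castRingHom ℝ)).eval x = 0 := by rw [hS]; simp
    rwa [eval_map] at this
  have hint : IsIntegral ℤ x := ⟨P, hP, hroot_x⟩
  refine ⟨(hint.tower_top (A := ℚ)).isAlgebraic, ?_⟩
  set m := minpoly ℤ x with hm
  have hmm : m.Monic := minpoly.monic hint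
  have hmQ : (minpoly ℚ x).natDegree = m.natDegree := by
    rw [minpoly.isIntegrallyClosed_eq_field_fractions' ℚ hint, hmm.natDegree_map]
  have hmult : (P.map (Int.castRingHom ℝ)).rootMultiplicity 1 = P.rootMultiplicity 1 := by
    have := eq_rootMultiplicity_map (p := P) (f := Int.castRingHom ℝ)
      (RingHom.injective_int _) 1
    rw [this, map_one]
  obtain ⟨q, hq, hq1⟩ := exists_eq_pow_rootMultiplicity_mul_and_not_dvd P hP.ne_zero 1
  rw [← hmult] at hq
  set d := (P.map (Int.castRingHom ℝ)).rootMultiplicity 1 with hd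
  have hqm : q.Monic := ((monic_X_sub_C 1).pow d).of_mul_monic_left (hq ▸ hP)
  have hmdvd : m ∣ q := by
    have hprime : Prime m := (minpoly.irreducible hint).prime
    have h1 : m ∣ (X - C 1) ^ d * q := by
      rw [← hq]
      exact minpoly.isIntegrallyClosed_dvd hint hroot_x
    refine (hprime.dvd_or_dvd h1).resolve_left fun h => ?_
    obtain ⟨e, he⟩ := hprime.dvd_of_dvd_pow h
    have h2 : aeval x (X - C (1 : ℤ)) = 0 := by
      rw [he, map_mul, hm, minpoly.aeval, zero_mul]
    simp only [map_sub, aeval_X, map_one] at h2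
    linarith
  obtain ⟨b, hb⟩ := hmdvd
  have hbm : b.Monic := hmm.of_mul_monic_left (hb ▸ hqm)
  have hPdeg : P.natDegree = d + (m.natDegree + b.natDegree) := by
    rw [← hmm.natDegree_mul hbm, ← hb]
    conv_lhs => rw [hq, ((monic_X_sub_C 1).pow d).natDegree_mul hqm,
      (monic_X_sub_C 1).natDegree_pow, natDegree_X_sub_C, mul_one]
  rw [hmQ]
  suffices hb0 : b.natDegree = 0 by omega
  by_contra hb0
  have hbP : b ∣ P := ⟨(X - C 1) ^ d * m, by rw [hq, hb]; ring⟩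
  have hbS : b.map (Int.castRingHom ℝ) ∣ S := by
    have hxm : (X - C x) ∣ m.map (Int.castRingHom ℝ) := by
      rw [dvd_iff_isRoot, IsRoot.def, eval_map]
      exact minpoly.aeval ℤ x
    obtain ⟨e, he⟩ := hxm
    refine ⟨(X - C 1) ^ d * e, mul_left_cancel₀ (X_sub_C_ne_zero x) ?_⟩
    rw [← hS, hq, hb, Polynomial.map_mul, Polynomial.map_mul, he, Polynomial.map_pow,
      Polynomial.map_sub, map_X, map_C, map_one]
    ring
  have hbroot : ∀ z : ℂ, aeval z b = 0 → ‖z‖ < ε ∨ ‖1 - z‖ < ε := by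
    intro z hz
    obtain ⟨e, he⟩ := hbS
    refine hroot z ?_
    rw [he, map_mul, ← algebraMap_int_eq, aeval_map_algebraMap, hz, zero_mul]
  have hbunit : IsUnit (b.eval 0) := isUnit_of_dvd_unit (eval_dvd hbP) hunit
  have h1 := eval_one_eq_zero_of_roots_near hbm (Nat.pos_of_ne_zero hb0) hbunit
    (show b.natDegree ≤ P.natDegree by omega) hε hbroot
  refine hq1 (dvd_iff_isRoot.2 ?_)
  rw [IsRoot.def, hb, eval_mul, h1, mul_zero]

end Arithmetic

/-! ### Entrywise positivity -/

section Positivity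

theorem one_apply_nonneg {ι : Type} [DecidableEq ι] (a b : ι) :
    (0 : ℝ) ≤ (1 : Matrix ι ι ℝ) a b := by
  rw [Matrix.one_apply]
  split_ifs <;> norm_num

variable {ι : Type} [Fintype ι] [DecidableEq ι]

theorem le_mul_apply_of_one_le {A B : Matrix ι ι ℝ}
    (hA : ∀ a b, (1 : Matrix ι ι ℝ) a b ≤ A a b) (hB : ∀ a b, (1 : Matrix ι ι ℝ) a b ≤ B a b)
    (a b : ι) : A a b ≤ (A * B) a b ∧ B a b ≤ (A * B) a b := by
  have hA0 : ∀ a b, 0 ≤ A a b := fun a b => (one_apply_nonneg a b).trans (hA a b)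
  have hB0 : ∀ a b, 0 ≤ B a b := fun a b => (one_apply_nonneg a b).trans (hB a b)
  have hA1 : 1 ≤ A a a := by simpa using hA a a
  have hB1 : 1 ≤ B b b := by simpa using hB b b
  rw [Matrix.mul_apply]
  exact ⟨(le_mul_of_one_le_right (hA0 a b) hB1).trans
      (Finset.single_le_sum (f := fun c => A a c * B c b)
        (fun c _ => mul_nonneg (hA0 a c) (hB0 c b)) (Finset.mem_univ b)),
    (le_mul_of_one_le_left (hB0 a b) hA1).trans
      (Finset.single_le_sum (f := fun c => A a c * B c b)
        (fun c _ => mul_nonneg (hA0 a c) (hB0 c b)) (Finset.mem_univ a))⟩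

theorem one_le_orderedProd {A : ℕ → Matrix ι ι ℝ}
    (hA : ∀ j a b, (1 : Matrix ι ι ℝ) a b ≤ A j a b) (K : ℕ) (a b : ι) :
    (1 : Matrix ι ι ℝ) a b ≤ orderedProd A K a b := by
  induction K generalizing a b with
  | zero => exact le_rfl
  | succ K ih => exact (ih a b).trans (le_mul_apply_of_one_le (hA K) ih a b).2

theorem le_orderedProd {A : ℕ → Matrix ι ι ℝ}
    (hA : ∀ j a b, (1 : Matrix ι ι ℝ) a b ≤ A j a b) {K j : ℕ} (hj : j < K) (a b : ι) :
    A j a b ≤ orderedProd A K a b := by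
  induction K with
  | zero => omega
  | succ K ih =>
    have h := le_mul_apply_of_one_le (hA K) (one_le_orderedProd hA K) a b
    rcases Nat.lt_succ_iff_lt_or_eq.1 hj with hj | rfl
    · exact (ih hj).trans h.2
    · exact h.1

theorem one_le_one_add_smul_diagonal_mul {W : Matrix ι ι ℝ} (hW : ∀ a b, 0 ≤ W a b) (g : ι)
    {c : ℝ} (hc : 0 ≤ c) (a b : ι) : (1 : Matrix ι ι ℝ) a b ≤
      (1 + c • (Matrix.diagonal (Pi.single g (1 : ℝ)) * W)) a b := by
  rw [Matrix.add_apply, Matrix.smul_apply, diagonal_single_mul_apply, smul_eq_mul]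
  split_ifs
  · exact le_add_of_nonneg_right (mul_nonneg hc (hW g b))
  · simp

theorem orderedProd_apply_of_forall_ne {W : Matrix ι ι ℝ} {g : ℕ → ι} {c : ℕ → ℝ} {K : ℕ} {a : ι}
    (ha : ∀ j < K, g j ≠ a) (b : ι) :
    orderedProd (fun j => 1 + c j • (Matrix.diagonal (Pi.single (g j) (1 : ℝ)) * W)) K a b =
      (1 : Matrix ι ι ℝ) a b := by
  induction K with
  | zero => rfl
  | succ K ih =>
    rw [orderedProd, add_mul, one_mul, Matrix.add_apply, ih fun j hj => ha j (by omega),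
      smul_mul_assoc, mul_assoc, Matrix.smul_apply, diagonal_single_mul_apply,
      if_neg (ha K (by omega)).symm, smul_zero, add_zero]

/-- A matrix dominating the identity is primitive if its entries along the edges of a connected
graph are positive. -/
theorem isPrimitive_of_one_le {M : Matrix ι ι ℝ} (hM : ∀ a b, (1 : Matrix ι ι ℝ) a b ≤ M a b)
    {G : SimpleGraph ι} (hG : G.Preconnected) (hpos : ∀ a b, G.Adj a b → 0 < M a b) :
    M.IsPrimitive := by
  have hM0 : ∀ a b, 0 ≤ M a b := fun a b => (one_apply_nonneg a b).trans (hM a b)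
  have hpow1 : ∀ (m : ℕ) a b, (1 : Matrix ι ι ℝ) a b ≤ (M ^ m) a b := by
    intro m
    induction m with
    | zero => exact fun _ _ => by rw [pow_zero]
    | succ m ih =>
      intro a b
      rw [pow_succ]
      exact (ih a b).trans (le_mul_apply_of_one_le ih hM a b).1
  have hmono : ∀ a b, Monotone fun m : ℕ => (M ^ m) a b := fun a b =>
    monotone_nat_of_le_succ fun m => by
      rw [pow_succ]
      exact (le_mul_apply_of_one_le (hpow1 m) hM a b).1
  have hwalk : ∀ {a b} (p : G.Walk a b), 0 < (M ^ p.length) a b := by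
    intro a b p
    induction p with
    | nil => simp
    | @cons u v w h p ih =>
      rw [SimpleGraph.Walk.length_cons, pow_succ', Matrix.mul_apply]
      exact (mul_pos (hpos _ _ h) ih).trans_le
        (Finset.single_le_sum (f := fun c => M u c * (M ^ p.length) c w)
          (fun c _ => mul_nonneg (hM0 u c)
            ((one_apply_nonneg c w).trans (hpow1 _ c w))) (Finset.mem_univ v))
  let p : ∀ a b, G.Walk a b := fun a b => (hG a b).some
  refine ⟨hM0, (∑ a, ∑ b, (p a b).length) + 1, Nat.succ_pos _, fun a b => ?_⟩
  refine (hwalk (p a b)).trans_le (hmono a b (Nat.le_succ_of_le ?_))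
  exact (Finset.single_le_sum (f := fun b => (p a b).length) (fun _ _ => Nat.zero_le _)
    (Finset.mem_univ b)).trans (Finset.single_le_sum (f := fun a => ∑ b, (p a b).length)
      (fun _ _ => Nat.zero_le _) (Finset.mem_univ a))

/-- The leading term of the trace is positive, since it contains the product of the weights along
the closed walk. -/
theorem trace_orderedProd_pos {W : Matrix ι ι ℝ} (hW : ∀ a b, 0 ≤ W a b) {g : ℕ → ι} {K : ℕ}
    (hK : 0 < K) (hg : ∀ j < K, 0 < W (g (j + 1)) (g j)) (hclosed : g K = g 0) :
    0 < (orderedProd (fun j => Matrix.diagonal (Pi.single (g j) (1 : ℝ)) * W) K).trace := by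
  set M := orderedProd fun j => Matrix.diagonal (Pi.single (g j) (1 : ℝ)) * W with hM
  have hnn : ∀ j a b, 0 ≤ (Matrix.diagonal (Pi.single (g j) (1 : ℝ)) * W) a b := by
    intro j a b
    rw [diagonal_single_mul_apply]
    split_ifs
    exacts [hW _ _, le_rfl]
  have hMnn : ∀ j a b, 0 ≤ M j a b := by
    intro j
    induction j with
    | zero => exact one_apply_nonneg
    | succ j ih =>
      intro a b
      rw [hM, orderedProd, Matrix.mul_apply]
      exact Finset.sum_nonneg fun c _ => mul_nonneg (hnn j a c) (ih c b)
  have hpos : ∀ j < K, ∀ b, 0 < W (g 0) b → 0 < M (j + 1) (g j) b := by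
    intro j
    induction j with
    | zero =>
      intro _ b hb
      rw [hM, orderedProd, orderedProd, mul_one, diagonal_single_mul_apply, if_pos rfl]
      exact hb
    | succ j ih =>
      intro hj b hb
      have h := mul_pos (hg j (by omega)) (ih (by omega) b hb)
      rw [hM, orderedProd, ← hM, Matrix.mul_apply]
      refine h.trans_le ((le_of_eq ?_).trans (Finset.single_le_sum
        (f := fun c => (Matrix.diagonal (Pi.single (g (j + 1)) (1 : ℝ)) * W) (g (j + 1)) c *
          M (j + 1) c b) (fun c _ => mul_nonneg (hnn _ _ c) (hMnn _ c b))
          (Finset.mem_univ (g j))))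
      simp only [diagonal_single_mul_apply, if_true]
  obtain ⟨m, rfl⟩ : ∃ m, K = m + 1 := ⟨K - 1, by omega⟩
  have hlast := hg m m.lt_succ_self
  rw [hclosed] at hlast
  exact (hpos m m.lt_succ_self _ hlast).trans_le
    (Finset.single_le_sum (f := fun a => M (m + 1) a a) (fun a _ => hMnn _ a a)
      (Finset.mem_univ (g m)))

end Positivity

/-! ### The limit of the rescaled characteristic polynomials -/

section Limit

theorem tendsto_orderedProd {R : Type*} [Monoid R] [TopologicalSpace R] [ContinuousMul R]
    {A : ℕ → ℕ → R} {B : ℕ → R} (h : ∀ j, Tendsto (fun k => A k j) atTop (𝓝 (B j))) (K : ℕ) :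
    Tendsto (fun k => orderedProd (A k) K) atTop (𝓝 (orderedProd B K)) := by
  induction K with
  | zero => exact tendsto_const_nhds
  | succ K ih => exact (h K).mul ih

variable {ι : Type} [Fintype ι] [DecidableEq ι]

theorem prod_smul_orderedProd (s : ℕ → ℝ) (A : ℕ → Matrix ι ι ℝ) (K : ℕ) :
    (∏ j ∈ Finset.range K, s j) • orderedProd A K = orderedProd (fun j => s j • A j) K := by
  induction K with
  | zero => simp [orderedProd]
  | succ K ih =>
    rw [orderedProd, orderedProd, ← ih, Finset.prod_range_succ, smul_mul_smul_comm, mul_comm]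

variable {W : ℕ → Matrix ι ι ℝ} {V : Matrix ι ι ℝ} {t : ℕ → ℝ} {g : ℕ → ι} {c : ℕ → ℝ}

/-- The product, divided by the product of the sizes `c_j t` of its factors, converges to the
product of the matrices `D_{g_j} V`. -/
theorem tendsto_smul_orderedProd (hc : ∀ j, 0 < c j) (ht : Tendsto t atTop atTop)
    (hW : Tendsto (fun k => (t k)⁻¹ • W k) atTop (𝓝 V)) (K : ℕ) :
    Tendsto (fun k => (∏ j ∈ Finset.range K, c j * t k)⁻¹ •
      orderedProd (fun j => 1 + c j • (Matrix.diagonal (Pi.single (g j) (1 : ℝ)) * W k)) K)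
      atTop (𝓝 (orderedProd (fun j => Matrix.diagonal (Pi.single (g j) (1 : ℝ)) * V) K)) := by
  simp only [← Finset.prod_inv_distrib, prod_smul_orderedProd]
  refine tendsto_orderedProd (fun j => ?_) K
  have h1 : Tendsto (fun k => (c j * t k)⁻¹ • (1 : Matrix ι ι ℝ)) atTop
      (𝓝 ((0 : ℝ) • (1 : Matrix ι ι ℝ))) :=
    ((ht.const_mul_atTop (hc j)).inv_tendsto_atTop).smul_const _
  have h2 : Tendsto (fun k => Matrix.diagonal (Pi.single (g j) (1 : ℝ)) * ((t k)⁻¹ • W k)) atTop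
      (𝓝 (Matrix.diagonal (Pi.single (g j) (1 : ℝ)) * V)) := tendsto_const_nhds.mul hW
  have h3 := h1.add h2
  rw [zero_smul, zero_add] at h3
  refine h3.congr fun k => ?_
  rw [smul_add, smul_smul, mul_inv_rev, mul_assoc, inv_mul_cancel₀ (hc j).ne', mul_one,
    Matrix.mul_smul]

open Polynomial in
/-- The rescaled characteristic polynomial converges, away from `1`, to the determinant of the
weighted matrix of pairings of the limit. -/
theorem tendsto_aeval_charpoly {A : Type*} [NormedField A] [NormedAlgebra ℝ A]
    (hc : ∀ j, 0 < c j) (ht : Tendsto t atTop atTop)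
    (hW : Tendsto (fun k => (t k)⁻¹ • W k) atTop (𝓝 V)) (K : ℕ) {z : A} (hz : z ≠ 1) :
    Tendsto (fun k => aeval z (C (∏ j ∈ Finset.range K, c j * t k)⁻¹ *
      (orderedProd (fun j => 1 + c j • (Matrix.diagonal (Pi.single (g j) (1 : ℝ)) * W k))
        K).charpoly)) atTop
      (𝓝 (((z - 1) ^ K)⁻¹ * ((z - 1) ^ Fintype.card ι *
        (-weightedGram (V.map (algebraMap ℝ A)) g K z).det))) := by
  have hz1 : (z - 1) ^ K ≠ 0 := pow_ne_zero _ (sub_ne_zero.2 hz)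
  have hentry : ∀ a b, Tendsto (fun k => (t k)⁻¹ * W k a b) atTop (𝓝 (V a b)) := fun a b => by
    have h1 := tendsto_pi_nhds.1 (tendsto_pi_nhds.1 hW a) b
    simpa using h1
  have hmat : Tendsto (fun k => (Matrix.of fun j l : Fin K =>
      (algebraMap ℝ A (c j * t k)⁻¹) * (if j = l then z - 1 else 0) -
        (if l < j then z else 1) * algebraMap ℝ A ((t k)⁻¹ * W k (g j) (g l)))) atTop
      (𝓝 (-weightedGram (V.map (algebraMap ℝ A)) g K z)) := by
    refine tendsto_pi_nhds.2 fun j => tendsto_pi_nhds.2 fun l => ?_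
    have h1 : Tendsto (fun k => algebraMap ℝ A (c j * t k)⁻¹) atTop (𝓝 (algebraMap ℝ A 0)) :=
      ((continuous_algebraMap ℝ A).tendsto 0).comp
        (ht.const_mul_atTop (hc j)).inv_tendsto_atTop
    have h2 : Tendsto (fun k => algebraMap ℝ A ((t k)⁻¹ * W k (g j) (g l))) atTop
        (𝓝 (algebraMap ℝ A (V (g j) (g l)))) :=
      ((continuous_algebraMap ℝ A).tendsto _).comp (hentry _ _)
    have h3 := (h1.mul_const (if j = l then z - 1 else 0)).sub
      (h2.const_mul (if l < j then z else 1))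
    rw [map_zero, zero_mul, zero_sub] at h3
    exact h3
  have hdet : Tendsto (fun k => (Matrix.of fun j l : Fin K =>
      (algebraMap ℝ A (c j * t k)⁻¹) * (if j = l then z - 1 else 0) -
        (if l < j then z else 1) * algebraMap ℝ A ((t k)⁻¹ * W k (g j) (g l))).det) atTop
      (𝓝 (-weightedGram (V.map (algebraMap ℝ A)) g K z).det) :=
    ((continuous_id.matrix_det).tendsto _).comp hmat
  refine ((hdet.const_mul ((z - 1) ^ Fintype.card ι)).const_mul ((z - 1) ^ K)⁻¹).congr' ?_
  filter_upwards [ht.eventually_gt_atTop 0] with k hk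
  have hmap : (orderedProd (fun j => 1 + c j • (Matrix.diagonal (Pi.single (g j) (1 : ℝ)) * W k))
      K).map (algebraMap ℝ A) = orderedProd (fun j => 1 + Matrix.vecMulVec (Pi.single (g j) 1)
        (fun b => algebraMap ℝ A (c j * W k (g j) b))) K := by
    rw [← RingHom.mapMatrix_apply, map_orderedProd]
    refine orderedProd_congr fun j _ => ?_
    rw [map_add, map_one]
    congr 1
    ext a b
    rw [RingHom.mapMatrix_apply, Matrix.map_apply, Matrix.smul_apply, diagonal_single_mul_apply,
      Matrix.vecMulVec_apply, Pi.single_apply]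
    split_ifs <;> simp
  have hformula := pow_mul_det_sub_orderedProd (fun j => Pi.single (g j) (1 : A))
    (fun j b => algebraMap ℝ A (c j * W k (g j) b)) K z
  rw [← hmap] at hformula
  have hchar : aeval z (orderedProd (fun j => 1 + c j •
      (Matrix.diagonal (Pi.single (g j) (1 : ℝ)) * W k)) K).charpoly =
      (z • (1 : Matrix ι ι A) - (orderedProd (fun j => 1 + c j •
      (Matrix.diagonal (Pi.single (g j) (1 : ℝ)) * W k)) K).map (algebraMap ℝ A)).det := by
    rw [← eval_map_algebraMap, ← Matrix.charpoly_map, Matrix.eval_charpoly,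
      Matrix.scalar_apply, ← Matrix.smul_one_eq_diagonal]
  rw [map_mul, aeval_C, hchar, ← mul_right_inj' hz1, mul_inv_cancel_left₀ hz1, mul_left_comm,
    hformula, mul_left_comm]
  congr 1
  rw [← Finset.prod_inv_distrib, map_prod, Finset.prod_range, ← Matrix.det_mul_column]
  congr 1
  ext j l
  have hval : algebraMap ℝ A ((t k)⁻¹ * W k (g j) (g l)) =
      algebraMap ℝ A (c j * t k)⁻¹ * algebraMap ℝ A (c j * W k (g j) (g l)) := by
    rw [← map_mul]
    have := (hc j).ne'
    congr 1
    field_simp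
  rw [Matrix.of_apply, Matrix.of_apply, Matrix.sub_apply, Matrix.smul_apply, Matrix.one_apply,
    Matrix.of_apply, dotProduct_single, mul_one, hval]
  split_ifs <;> simp only [smul_eq_mul] <;> ring

end Limit

/-! ### Path products -/

section PathProduct

variable {n : ℕ} {i : Fin n} (γ : (⊤ : SimpleGraph (Fin n)).Walk i i) (p : Fin γ.length → ℕ)

/-- The exponents of a path product as a sequence, continued by the value `1`. -/
def exponent (j : ℕ) : ℕ := if h : j < γ.length then p ⟨j, h⟩ else 1

theorem exponent_pos (hp : ∀ k, 0 < p k) (j : ℕ) : 0 < exponent γ p j := by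
  rw [exponent]
  split_ifs
  exacts [hp _, one_pos]

theorem pathProduct_apply (Ω : space n) :
    pathProduct γ p Ω = orderedProd (fun j => 1 + (exponent γ p j : ℝ) •
      (Matrix.diagonal (Pi.single (γ.getVert j) (1 : ℝ)) * Ω.1)) γ.length := by
  have h1 : pathProduct γ p =
      orderedProd (fun j => Q (γ.getVert j) ^ exponent γ p j) γ.length := by
    rw [← prod_reverse_ofFn, pathProduct]
    congr 3
    ext1 k
    rw [exponent, dif_pos k.2]
  have h2 := map_orderedProd (Pi.evalMonoidHom (fun _ : space n => Matrix (Fin n) (Fin n) ℝ) Ω)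
    (fun j => Q (γ.getVert j) ^ exponent γ p j) γ.length
  rw [h1]
  refine h2.trans (orderedProd_congr fun j _ => ?_)
  rw [← one_add_diagonal_mul_pow _ (Ω.2.2.2 _)]
  rfl

/-- A path whose product is general visits all vertices: otherwise some row of the product would be
a row of the identity for all `Ω`. -/
theorem exists_getVert_eq_of_isGeneral [Nontrivial (Fin n)] (hgen : IsGeneral (pathProduct γ p))
    (a : Fin n) : ∃ j < γ.length, γ.getVert j = a := by
  by_contra! hcon
  obtain ⟨b, hba⟩ := exists_ne a
  obtain ⟨l, hl, hprod⟩ := hgen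
  -- the matrix with all entries off the diagonal equal to one
  let J : space n := ⟨Matrix.of fun a b => if a = b then 0 else 1,
    by ext a b; simp [Matrix.transpose_apply, eq_comm],
    fun a b => by simp only [Matrix.of_apply]; split_ifs <;> norm_num, fun a => by simp⟩
  have hQ : ∀ c a b, (1 : Matrix (Fin n) (Fin n) ℝ) a b ≤ Q c J a b := fun c a b => by
    have := one_le_one_add_smul_diagonal_mul (W := J.1) J.2.2.1 c zero_le_one a b
    rwa [one_smul] at this
  have hlist : ∀ l : List (Fin n),
      (∀ a b, (1 : Matrix (Fin n) (Fin n) ℝ) a b ≤ (l.map Q).prod J a b) ∧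
        ∀ c ∈ l, ∀ a b, Q c J a b ≤ (l.map Q).prod J a b := by
    intro l
    induction l with
    | nil => exact ⟨fun _ _ => le_rfl, fun c hc => absurd hc List.not_mem_nil⟩
    | cons d l ih =>
      have hmul := le_mul_apply_of_one_le (hQ d) ih.1
      rw [List.map_cons, List.prod_cons]
      refine ⟨fun a b => (ih.1 a b).trans (hmul a b).2, fun c hc a b => ?_⟩
      rcases List.mem_cons.1 hc with rfl | hc
      · exact (hmul a b).1
      · exact (ih.2 c hc a b).trans (hmul a b).2
  have h1 := (hlist l).2 a (hl a) a b
  have hrow := orderedProd_apply_of_forall_ne (W := J.1) (c := fun j => (exponent γ p j : ℝ)) hcon b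
  rw [← pathProduct_apply] at hrow
  rw [← hprod, hrow, Q, Matrix.add_apply, diagonal_single_mul_apply, if_pos rfl,
    Matrix.one_apply_ne hba.symm, zero_add] at h1
  have hJ : J.1 a b = 1 := if_neg hba.symm
  rw [hJ] at h1
  norm_num at h1

/-- At integral points, the characteristic polynomial of the path product has integer coefficients
and constant term `±1`. -/
theorem exists_charpoly_eq_map {Ω : space n} (hΩ : IsIntegralPoint Ω) :
    ∃ P : Polynomial ℤ, P.Monic ∧ P.natDegree = n ∧ IsUnit (P.eval 0) ∧
      P.map (Int.castRingHom ℝ) = (pathProduct γ p Ω).charpoly := by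
  choose z hz using hΩ
  set Z : Matrix (Fin n) (Fin n) ℤ := Matrix.of z with hZ
  have hZdiag : ∀ a, Z a a = 0 := fun a => by
    have := hz a a
    rw [Ω.2.2.2 a] at this
    exact_mod_cast this.symm
  set A : ℕ → Matrix (Fin n) (Fin n) ℤ := fun j =>
    (1 + Matrix.diagonal (Pi.single (γ.getVert j) (1 : ℤ)) * Z) ^ exponent γ p j with hA
  have hunit : ∀ j, IsUnit (A j) := fun j => by
    refine IsUnit.pow _ ?_
    set X := Matrix.diagonal (Pi.single (γ.getVert j) (1 : ℤ)) * Z with hX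
    have hsq : X * X = 0 := by
      rw [hX, diagonal_single_mul_eq_vecMulVec, Matrix.vecMulVec_mul_vecMulVec]
      simp [hZdiag]
    refine IsUnit.of_mul_eq_one (1 - X) ?_
    rw [mul_sub, mul_one, add_mul, one_mul, hsq, add_zero, add_sub_cancel_right]
  have hprod : ∀ K, IsUnit (orderedProd A K) := fun K => by
    induction K with
    | zero => exact isUnit_one
    | succ K ih => exact (hunit K).mul ih
  refine ⟨(orderedProd A γ.length).charpoly, Matrix.charpoly_monic _, ?_, ?_, ?_⟩
  · rw [Matrix.charpoly_natDegree_eq_dim, Fintype.card_fin]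
  · rw [Matrix.eval_charpoly, map_zero, zero_sub]
    exact (Matrix.isUnit_iff_isUnit_det _).1 (hprod _).neg
  · rw [← Matrix.charpoly_map, ← RingHom.mapMatrix_apply, map_orderedProd, pathProduct_apply]
    congr 1
    refine orderedProd_congr fun j _ => ?_
    rw [hA]
    simp only [map_pow, map_add, map_one, map_mul]
    rw [← one_add_diagonal_mul_pow _ (Ω.2.2.2 _)]
    congr 3
    · ext a b
      rw [RingHom.mapMatrix_apply, Matrix.map_apply, Matrix.diagonal_apply, Matrix.diagonal_apply,
        Pi.single_apply, Pi.single_apply]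
      split_ifs <;> simp
    · ext a b
      rw [RingHom.mapMatrix_apply, Matrix.map_apply, hz]
      rfl

end PathProduct

theorem getVert_transfer {V : Type*} {G H : SimpleGraph V} {u v : V} (w : G.Walk u v)
    (h : ∀ e ∈ w.edges, e ∈ H.edgeSet) (j : ℕ) : (w.transfer H h).getVert j = w.getVert j := by
  induction w generalizing j with
  | nil => rfl
  | cons hadj w ih =>
    cases j with
    | zero => rfl
    | succ j => exact ih _ j

/-- If the path is contractible or the rank is two, the limit of the rescaled characteristic
polynomials has no complex roots besides `0` and `1`. -/
theorem det_weightedGram_rep_ne_zero {n : ℕ} {i : Fin n} {γ : (⊤ : SimpleGraph (Fin n)).Walk i i}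
    {ρ : Boundary n} (hγ : PathIn γ ρ.graph)
    (hcase : Contractible (γ.transfer ρ.graph hγ) ∨ ρ.rank = 2) {z : ℂ} (hz0 : z ≠ 0)
    (hz1 : z ≠ 1) :
    (weightedGram (ρ.rep.1.map (algebraMap ℝ ℂ)) γ.getVert γ.length z).det ≠ 0 := by
  have hW : ∀ u v, ρ.graph.Adj u v → (ρ.rep.1.map (algebraMap ℝ ℂ)) v u ≠ 0 := fun u v h => by
    have h : 0 < ρ.rep.1 v u := h.symm
    simpa using h.ne'
  have hdiag : ∀ u, (ρ.rep.1.map (algebraMap ℝ ℂ)) u u = 0 := fun u => by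
    simp [ρ.rep.2.2.2 u]
  have hvert : (γ.transfer ρ.graph hγ).getVert = γ.getVert := funext (getVert_transfer γ hγ)
  have hlen : (γ.transfer ρ.graph hγ).length = γ.length := SimpleGraph.Walk.length_transfer ..
  rw [← hvert, ← hlen]
  rcases hcase with h | h
  · exact det_weightedGram_ne_zero_of_contractible hW hdiag h hz0 hz1
  · exact det_weightedGram_ne_zero_of_ker hW hdiag
      (fun u v huv y => mulVec_eq_zero_of_rank_eq_two ρ.rep h huv) _ hz0 hz1

end Penner

theorem mainTheorem8 {n : ℕ} {i : Fin n} (γ : (⊤ : SimpleGraph (Fin n)).Walk i i)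
    (p : Fin γ.length → ℕ) (hp : ∀ k, 0 < p k)
    (hgen : Penner.IsGeneral (Penner.pathProduct γ p))
    (r : ℕ) (Ω : ℕ → Penner.space n)
    (hint : ∀ k, Penner.IsIntegralPoint (Ω k))
    (hrank : ∀ k, (Ω k).1.rank = r)
    (Ωstar : Penner.Boundary n)
    (hlim : Penner.ConvergesToBoundary Ω Ωstar)
    (hγ : Penner.PathIn γ Ωstar.graph)
    (hcase : Penner.Contractible (γ.transfer Ωstar.graph hγ) ∨ Ωstar.rank = 2) :
    ∀ᶠ k in atTop,
      (Penner.pathProduct γ p (Ω k)).IsPrimitive ∧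
      ∃ μ : ℝ, Penner.IsPerronFrobeniusEigenvalue (Penner.pathProduct γ p (Ω k)) μ ∧
        IsAlgebraic ℚ μ ∧ (minpoly ℚ μ).natDegree = r := by
  obtain ⟨t, ht, hconv⟩ := hlim
  -- a nonzero matrix with zero diagonal has at least two rows
  have hnontriv : Nontrivial (Fin n) := by
    by_contra h
    rw [not_nontrivial_iff_subsingleton] at h
    refine Ωstar.rep_ne_zero (Matrix.ext fun a b => ?_)
    rw [Subsingleton.elim b a]
    exact Ωstar.rep.2.2.2 a
  have hn : 2 ≤ n := Fin.nontrivial_iff_two_le.1 hnontriv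
  obtain ⟨N, rfl⟩ : ∃ N, n = N + 1 := ⟨n - 1, by omega⟩
  have hvisit := Penner.exists_getVert_eq_of_isGeneral γ p hgen
  have hK : 0 < γ.length := by
    obtain ⟨j, hj, -⟩ := hvisit i
    omega
  set g := γ.getVert with hg
  set c : ℕ → ℝ := fun j => Penner.exponent γ p j with hcdef
  have hc : ∀ j, 0 < c j := fun j => Nat.cast_pos.2 (Penner.exponent_pos γ p hp j)
  have hM : ∀ k, Penner.pathProduct γ p (Ω k) = Penner.orderedProd (fun j => 1 + c j •
      (Matrix.diagonal (Pi.single (g j) (1 : ℝ)) * (Ω k).1)) γ.length :=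
    fun k => Penner.pathProduct_apply γ p (Ω k)
  have hvert : ∀ j, (γ.transfer Ωstar.graph hγ).getVert j = g j := Penner.getVert_transfer γ hγ
  have hlen : (γ.transfer Ωstar.graph hγ).length = γ.length :=
    SimpleGraph.Walk.length_transfer ..
  have hadj : ∀ j < γ.length, Ωstar.graph.Adj (g j) (g (j + 1)) := fun j hj => by
    have := (γ.transfer Ωstar.graph hγ).adj_getVert_succ (i := j) (hlen.symm ▸ hj)
    rwa [hvert, hvert] at this
  have hconn : Ωstar.graph.Preconnected := by
    have hreach : ∀ a, Ωstar.graph.Reachable i a := fun a => by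
      obtain ⟨j, -, hj⟩ := hvisit a
      have := ((γ.transfer Ωstar.graph hγ).take j).reachable
      rwa [hvert, hj] at this
    exact fun a b => (hreach a).symm.trans (hreach b)
  set T : ℕ → ℝ := fun k => ∏ j ∈ Finset.range γ.length, c j * t k with hTdef
  have hT : Tendsto T atTop atTop := by
    have hTk : ∀ k, T k = (∏ j ∈ Finset.range γ.length, c j) * t k ^ γ.length := fun k => by
      rw [hTdef]
      simp only
      rw [Finset.prod_mul_distrib, Finset.prod_const, Finset.card_range]
    rw [funext hTk]
    exact ((tendsto_pow_atTop hK.ne').comp ht).const_mul_atTop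
      (Finset.prod_pos fun j _ => hc j)
  -- the rescaled characteristic polynomials converge
  set f : ℕ → Polynomial ℝ := fun k => (Penner.pathProduct γ p (Ω k)).charpoly with hfdef
  have hf : ∀ k, (f k).Monic ∧ (f k).natDegree = N + 1 := fun k =>
    ⟨Matrix.charpoly_monic _, by
      rw [hfdef]; simp only; rw [Matrix.charpoly_natDegree_eq_dim, Fintype.card_fin]⟩
  have heval : ∀ {A : Type} [NormedField A] [NormedAlgebra ℝ A] {z : A}, z ≠ 1 →
      Tendsto (fun k => Polynomial.aeval z (Polynomial.C (T k)⁻¹ * f k)) atTop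
        (𝓝 (((z - 1) ^ γ.length)⁻¹ * ((z - 1) ^ Fintype.card (Fin (N + 1)) *
          (-Penner.weightedGram (Ωstar.rep.1.map (algebraMap ℝ A)) g γ.length z).det))) := by
    intro A _ _ z hz
    simp only [hfdef, hM]
    exact Penner.tendsto_aeval_charpoly hc ht hconv γ.length hz
  obtain ⟨ℓ, hℓ⟩ := Penner.exists_tendsto_coeff_of_tendsto_eval
    (f := fun k => Polynomial.C (T k)⁻¹ * f k) (N := N + 1)
    (fun k => (Polynomial.natDegree_C_mul_le _ _).trans (hf k).2.le)
    (fun x hx => ⟨_, heval hx.ne'⟩)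
  have hℓ' : ∀ j, Tendsto (fun k => (T k)⁻¹ * (f k).coeff j) atTop (𝓝 (ℓ.coeff j)) := by
    simpa only [Polynomial.coeff_C_mul] using hℓ
  have hℓdeg : ℓ.natDegree ≤ N := by
    refine Polynomial.natDegree_le_iff_coeff_eq_zero.2 fun j hj => ?_
    refine tendsto_nhds_unique (hℓ' j) ?_
    rcases (Nat.succ_le_of_lt hj).lt_or_eq with hj | rfl
    · refine tendsto_const_nhds.congr fun k => ?_
      rw [Polynomial.coeff_eq_zero_of_natDegree_lt ((hf k).2.trans_lt hj), mul_zero]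
    · refine hT.inv_tendsto_atTop.congr fun k => ?_
      have := (hf k).1.coeff_natDegree
      rw [(hf k).2] at this
      rw [this, mul_one, Pi.inv_apply]
  have hℓneg : ℓ.coeff N < 0 := by
    have htr := ((continuous_id.matrix_trace (n := Fin (N + 1)) (R := ℝ)).tendsto _).comp
      (Penner.tendsto_smul_orderedProd (g := g) hc ht hconv γ.length)
    have hpos := Penner.trace_orderedProd_pos Ωstar.rep.2.2.1 hK
      (fun j hj => (hadj j hj).symm) (by rw [hg, γ.getVert_length, γ.getVert_zero])
    have heq := tendsto_nhds_unique (hℓ' N) (htr.neg.congr fun k => by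
      rw [Function.comp_apply, id, Matrix.trace_smul, ← hM, Matrix.trace_eq_neg_charpoly_coeff,
        Fintype.card_fin, Nat.add_sub_cancel, smul_eq_mul, mul_neg, neg_neg])
    rw [heq]
    exact neg_neg_of_pos hpos
  have hℓroot : ∀ z : ℂ, Polynomial.aeval z ℓ = 0 → z = 0 ∨ z = 1 := by
    intro z hz
    by_contra! hcon
    have h1 := tendsto_nhds_unique (Penner.tendsto_aeval_of_tendsto_coeff
      (fun k => (Polynomial.natDegree_C_mul_le _ _).trans (hf k).2.le)
      (hℓdeg.trans N.le_succ) hℓ z) (heval hcon.2)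
    have hz1 : z - 1 ≠ 0 := sub_ne_zero.2 hcon.2
    rw [hz, eq_comm, Matrix.det_neg] at h1
    refine mul_ne_zero (inv_ne_zero (pow_ne_zero _ hz1)) (mul_ne_zero (pow_ne_zero _ hz1)
      (mul_ne_zero (pow_ne_zero _ (by norm_num)) ?_)) h1
    exact Penner.det_weightedGram_rep_ne_zero hγ hcase hcon.1 hcon.2
  -- this value makes a product of one small root and at most `n` roots of modulus `≤ 2` small
  set ε : ℝ := 1 / 2 ^ (N + 2) with hε
  have hgreat := Penner.eventually_exists_greatest_root hf (by omega) hT hℓdeg hℓneg hℓ' hℓroot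
    (show 0 < ε by positivity)
  have hedge : ∀ᶠ k in atTop, ∀ a b, Ωstar.graph.Adj a b → 0 < (Ω k).1 a b := by
    refine eventually_all.2 fun a => eventually_all.2 fun b => ?_
    by_cases hab : Ωstar.graph.Adj a b
    · have h1 := tendsto_pi_nhds.1 (tendsto_pi_nhds.1 hconv a) b
      filter_upwards [h1.eventually_const_lt (show 0 < Ωstar.rep.1 a b from hab),
        ht.eventually_gt_atTop 0] with k hk htk _
      rw [Matrix.smul_apply, smul_eq_mul] at hk
      exact (pos_iff_pos_of_mul_pos hk).1 (inv_pos.2 htk)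
    · exact Eventually.of_forall fun k h => absurd h hab
  filter_upwards [hgreat, hedge] with k hk hek
  constructor
  · have hfac := fun j => Penner.one_le_one_add_smul_diagonal_mul (Ω k).2.2.1 (g j) (hc j).le
    rw [hM]
    refine Penner.isPrimitive_of_one_le (Penner.one_le_orderedProd hfac _) hconn fun a b hab => ?_
    obtain ⟨j, hj, rfl⟩ := hvisit a
    refine lt_of_lt_of_le ?_ (Penner.le_orderedProd hfac hj _ _)
    rw [Matrix.add_apply, Matrix.smul_apply, Penner.diagonal_single_mul_apply, if_pos rfl,
      Matrix.one_apply_ne hab.ne, zero_add, smul_eq_mul]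
    exact mul_pos (hc j) (hek _ _ hab)
  · obtain ⟨x, hx1, hxg, S, hS, hSroot⟩ := hk
    obtain ⟨P, hP, hPdeg, hPunit, hPmap⟩ := Penner.exists_charpoly_eq_map γ p (hint k)
    refine ⟨x, ?_, ?_⟩
    · rw [Penner.IsPerronFrobeniusEigenvalue]
      simp only [Module.End.hasEigenvalue_iff_isRoot_charpoly, Matrix.charpoly_toLin']
      exact hxg
    · have hεP : ε * 2 ^ P.natDegree < 1 := by
        rw [hPdeg, hε, pow_succ 2 (N + 1)]
        have : (0 : ℝ) < 2 ^ (N + 1) := by positivity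
        field_simp
        norm_num
      obtain ⟨halg, hdeg⟩ := Penner.natDegree_minpoly_eq_of_roots_near hP hPunit hεP hx1
        (hPmap.trans hS) hSroot
      refine ⟨halg, ?_⟩
      have hmult := Penner.rootMultiplicity_one_charpoly_add_rank (Ω k).2.1 (Ω k).2.2.2 hc hvisit
      rw [← hM, hrank, ← hPmap, Fintype.card_fin] at hmult
      omega
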